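/- **Setting.** Let $\mathcal A$ be an alphabet with $n\ge 2$ letters. A generalized permutation is $\hat\pi=(\pi_0,|\pi_1|,F)$ with bijections $\pi_0,|\pi_1|:\mathcal A\to\{1,\dots,n\}$ and a flip set $F\subset\mathcal A$. It is irreducible if $\pi_0^{-1}\{1,\dots,k\}\neq|\pi_1|^{-1}\{1,\dots,k\}$ for all $1\le k<n$. Put $\alpha_0=\pi_0^{-1}(n)$, $\alpha_1=|\pi_1|^{-1}(n)$. There are two moves: in move $a$ the winner is $\alpha_0$ and the loser is $\alpha_1$; in move $b$ the winner is $\alpha_1$ and the loser is $\alpha_0$. A move takes the loser from the end of the row ($|\pi_1|$ for $a$, $\pi_0$ for $b$) in which it is last and reinserts it in this row immediately after the winner if the winner is not in $F$; if the winner is in $F$, the loser is reinserted immediately before the winner and its membership in $F$ is reversed. The matrix of the move is $E+E_{w,l}$ ($w$ winner, $l$ loser). Rauzy induction $R$ acts on pairs $(\hat\pi,\lambda)$, $\lambda\in\mathbb R_+^{\mathcal A}$: if $\hat\pi$ is irreducible and $\lambda_{\alpha_0}>\lambda_{\alpha_1}$ (resp. $\lambda_{\alpha_0}<\lambda_{\alpha_1}$)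 it applies the move $a$ (resp. $b$) to $\hat\pi$ and replaces $\lambda_w$ by $\lambda_w-\lambda_l$; otherwise it is undefined (the induction stops). The accelerated induction is $Z(\hat\pi,\lambda)=R^j(\hat\pi,\lambda)$, where $j\ge1$ is the first time at which the move to be performed is not the one performed at time $0$ (it is the opposite one, or the induction stops). A path $\gamma$ is a finite sequence of moves, each of them starting at an irreducible generalized permutation; $R_\gamma$ is the product of the matrices of its moves in order, so that $\lambda=R_\gamma\lambda'$ relates the lengths before and after. The path is complete if every letter wins in some move of $\gamma$, and positive if all entries of $R_\gamma$ are positive. For a path $\gamma$ starting at $\hat\pi$ let $$\Delta_\gamma=\{\lambda\in R_\gamma\mathbb R_+^{\mathcal A}:\ \|\lambda\|=1\},\qquad \|\lambda\|=\sum_\alpha\lambda_\alpha .$$ **Roof function.** Let $\hat\pi$ be a generalized permutation with $F\ne\emptyset$ and let $\gamma_*$ be a positive complete path starting and ending at $\hat\pi$. Consider the first return map to $\Delta_{\gamma_*}\times\{\hat\pi\}$ of the projectivization $(\hat\pi,\lambda)\mapsto(\hat\pi',\lambda'/\|\lambda'\|)$ of the induction, either the accelerated one $Z$ or the plain one $R$.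 For $\lambda\in\Delta_{\gamma_*}$ define $$r(\lambda,\hat\pi)=-\log\|R_\gamma^{-1}\lambda\|,$$ where $\gamma$ is the path followed by $(\hat\pi,\lambda)$ until its first return. If the orbit does not return because the Rauzy induction stops, after exactly $N$ steps, then $r$ is defined by one of the two conventions: $r=\log N$, or $r=-\log\|R_\gamma^{-1}\lambda\|$ for the path $\gamma$ of these $N$ steps. If the orbit neither returns nor stops, $r=+\infty$. **Theorem.** The roof function has exponential tails: there exists $\sigma>0$ such that $$\int_{\Delta_{\gamma_*}}e^{\sigma r(\lambda,\hat\pi)}\,dLeb(\lambda)<\infty ,$$ where $Leb$ is $(n-1)$-dimensional Lebesgue measure on the simplex $\{\|\lambda\|=1\}$. This holds for the plain and for the accelerated induction and for both conventions. -/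

import Mathlib

open MeasureTheory Set
open scoped ENNReal

namespace FIET

/-- A generalized permutation on the alphabet `A` with `n` letters: `top` is `π₀`, `bot` is
`|π₁|`, and `flipped` is the indicator of the flip set. Positions are counted from `0`. -/
@[ext]
structure GenPerm (A : Type*) (n : ℕ) where
  top : A ≃ Fin n
  bot : A ≃ Fin n
  flipped : A → Bool

/-- The two operations of Rauzy induction: in `a` the last letter of the top row wins, in `b` the
last letter of the bottom row wins. -/
inductive Move
  | a
  | b

/-- The row obtained from `p` by taking away its last letter and inserting it next to the letter
`w`: immediately before `w` if `before = true`, immediately after `w` otherwise.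
(`Fin.cycleIcc i ⊤` sends the last position to `i`, and every other position `k ≥ i`
to `k + 1`.) -/
def insertLast {A : Type*} {n : ℕ} [NeZero n] (p : A ≃ Fin n) (w : A) (before : Bool) :
    A ≃ Fin n :=
  p.trans (Fin.cycleIcc (if before = true then p w else p w + 1) ⊤)

namespace GenPerm

variable {A : Type*} {n : ℕ}

/-- Irreducibility: for `1 ≤ k < n`, the first `k` letters of the two rows are different sets. -/
def Irreducible (π : GenPerm A n) : Prop :=
  ∀ k : ℕ, 1 ≤ k → k < n → {α : A | (π.top α : ℕ) < k} ≠ {α : A | (π.bot α : ℕ) < k}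

/-- The winner of an arrow. -/
def winner [NeZero n] (π : GenPerm A n) : Move → A
  | .a => π.top.symm ⊤
  | .b => π.bot.symm ⊤

/-- The loser of an arrow. -/
def loser [NeZero n] (π : GenPerm A n) : Move → A
  | .a => π.bot.symm ⊤
  | .b => π.top.symm ⊤

/-- The transition maps `a` and `b`: the loser is the last letter of the row in which the winner
is not last, and it is moved next to the winner in that row: after the winner if the winner is
not flipped; before the winner, and with its own orientation reversed, if the winner is
flipped. -/
def move [NeZero n] [DecidableEq A] (π : GenPerm A n) (t : Move) : GenPerm A n where
  top := match t with
    | .a => π.top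
    | .b => insertLast π.top (π.winner t) (π.flipped (π.winner t))
  bot := match t with
    | .a => insertLast π.bot (π.winner t) (π.flipped (π.winner t))
    | .b => π.bot
  flipped := Function.update π.flipped (π.loser t)
    (xor (π.flipped (π.loser t)) (π.flipped (π.winner t)))

/-- The transition matrices: `E + E_{winner, loser}`. -/
def stepMatrix [NeZero n] [DecidableEq A] (π : GenPerm A n) (t : Move) : Matrix A A ℝ :=
  1 + Matrix.single (π.winner t) (π.loser t) 1

/-- `γ` is a finite path of the Rauzy diagram starting at `π`: arrows start only at irreducible
vertices. -/
def IsPath [NeZero n] [DecidableEq A] (π : GenPerm A n) : List Move → Prop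
  | [] => True
  | t :: γ => π.Irreducible ∧ (π.move t).IsPath γ

/-- The last vertex of a path. -/
def endpoint [NeZero n] [DecidableEq A] (π : GenPerm A n) : List Move → GenPerm A n
  | [] => π
  | t :: γ => (π.move t).endpoint γ

/-- The list of winners of the arrows of a path. -/
def winners [NeZero n] [DecidableEq A] (π : GenPerm A n) : List Move → List A
  | [] => []
  | t :: γ => π.winner t :: (π.move t).winners γ

/-- The matrix `R_γ` of a path `γ`; old and new lengths are related by `λ = R_γ λ'`. -/
def pathMatrix [NeZero n] [Fintype A] [DecidableEq A] (π : GenPerm A n) :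
    List Move → Matrix A A ℝ
  | [] => 1
  | t :: γ => π.stepMatrix t * (π.move t).pathMatrix γ

/-- A path is complete if every letter is the winner of some arrow of it. -/
def IsComplete [NeZero n] [DecidableEq A] (π : GenPerm A n) (γ : List Move) : Prop :=
  ∀ α : A, α ∈ π.winners γ

/-- A path is positive if all entries of its matrix are positive. -/
def IsPositive [NeZero n] [Fintype A] [DecidableEq A] (π : GenPerm A n) (γ : List Move) : Prop :=
  ∀ α β : A, 0 < π.pathMatrix γ α β

/-- The subsimplex `Δ_γ` of the normalized length vectors lying in `R_γ ℝ₊ⁿ`. -/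
def subsimplex [NeZero n] [Fintype A] [DecidableEq A] (π : GenPerm A n) (γ : List Move) :
    Set (A → ℝ) :=
  {lam | ∑ α, lam α = 1 ∧ ∃ mu : A → ℝ, (∀ α, 0 < mu α) ∧ lam = (π.pathMatrix γ).mulVec mu}

end GenPerm

section Induction

variable {A : Type*} {n : ℕ}

/-- The data `(π̂, λ)` of an interval exchange transformation with flips. -/
abbrev Data (A : Type*) (n : ℕ) : Type _ := GenPerm A n × (A → ℝ)

open Classical in
/-- The operation that Rauzy induction performs at `x`: none if the permutation is reducible (the
hole) or if the two last intervals have the same length; otherwise the longer one wins. -/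
noncomputable def rauzyType [NeZero n] (x : Data A n) : Option Move :=
  if x.1.Irreducible then
    if x.2 (x.1.bot.symm ⊤) < x.2 (x.1.top.symm ⊤) then some .a
    else if x.2 (x.1.top.symm ⊤) < x.2 (x.1.bot.symm ⊤) then some .b
    else none
  else none

/-- Rauzy induction `R`, a partial map: the loser's length is subtracted from the winner's. -/
noncomputable def rauzyStep [NeZero n] [DecidableEq A] (x : Data A n) : Option (Data A n) :=
  (rauzyType x).map fun t =>
    (x.1.move t,
      Function.update x.2 (x.1.winner t) (x.2 (x.1.winner t) - x.2 (x.1.loser t)))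

/-- The `k`-th iterate of a partial map. -/
def iter {X : Type*} (F : X → Option X) : ℕ → X → Option X
  | 0, x => some x
  | k + 1, x => (iter F k x).bind F

/-- `R^j x` is defined with `j ≥ 1`, and the operation performed at `R^j x` is not the one performed
at `x`: it is the opposite one, or the induction stops at `R^j x`. -/
def ChangesAt [NeZero n] [DecidableEq A] (x : Data A n) (j : ℕ) : Prop :=
  1 ≤ j ∧ ∃ y, iter rauzyStep j x = some y ∧ rauzyType y ≠ rauzyType x

open Classical in
/-- The accelerated (Zorich) induction `Z x = R^j x`, where `j ≥ 1` is the first time at which the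
operation changes; if Rauzy induction stops before it changes, then the last possible
application of `R` is used. -/
noncomputable def zorichStep [NeZero n] [DecidableEq A] (x : Data A n) : Option (Data A n) :=
  if h : ∃ j, ChangesAt x j then iter rauzyStep (Nat.find h) x else none

/-- The plain (`accelerated = false`) or the accelerated (`accelerated = true`) induction. -/
noncomputable def induction [NeZero n] [DecidableEq A] (accelerated : Bool) :
    Data A n → Option (Data A n) :=
  if accelerated = true then zorichStep else rauzyStep

/-- Projectivization: the lengths are divided by their sum. Since the induction commutes with
rescaling of the lengths, the orbits of the projectivized induction are the projections of the
orbits of the induction. -/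
noncomputable def normalize [Fintype A] (x : Data A n) : Data A n :=
  (x.1, fun α => x.2 α / ∑ β, x.2 β)

/-- The orbit of `x` under the projectivized induction is in `Δ_γ × {π}` at the time `k ≥ 1`. -/
def ReturnsAt [NeZero n] [Fintype A] [DecidableEq A] (accelerated : Bool) (π : GenPerm A n)
    (γ : List Move) (x : Data A n) (k : ℕ) : Prop :=
  1 ≤ k ∧ ∃ y, iter (induction accelerated) k x = some y ∧
    (normalize y).1 = π ∧ (normalize y).2 ∈ π.subsimplex γ

/-- Rauzy induction can be applied exactly `N` times to `x`. -/
def StopsAt [NeZero n] [DecidableEq A] (x : Data A n) (N : ℕ) : Prop :=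
  ∃ y, iter rauzyStep N x = some y ∧ rauzyStep y = none

/-- `-log ‖λ'‖` where `λ'` is the (not normalized) length vector of the data reached (the value is
irrelevant if nothing is reached). If a path `γ` leads from `(π, λ)` to it, then
`λ' = R_γ⁻¹ λ`. -/
noncomputable def renormTime [Fintype A] : Option (Data A n) → EReal
  | some y => ((-Real.log (∑ α, y.2 α) : ℝ) : EReal)
  | none => ⊤

/-- The two conventions for the roof function at a point whose orbit does not return because the
induction stops: the logarithm of the number of iterations of Rauzy induction, or the standard
formula for the longest possible path. -/
inductive StopConvention
  | logIterations
  | longestPath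

open Classical in
/-- The roof function of the first return map to `Δ_γ × {π}`. At a point that returns it is
`-log ‖R_δ⁻¹ λ‖`, where `δ` is the path followed up to the first return. At a point where the
induction stops without a return, it is given by the chosen convention. If the induction
never stops and there is no return, it is `+∞`. -/
noncomputable def roof [NeZero n] [Fintype A] [DecidableEq A] (accelerated : Bool)
    (conv : StopConvention) (π : GenPerm A n) (γ : List Move) (lam : A → ℝ) : EReal :=
  if h : ∃ k, ReturnsAt accelerated π γ (π, lam) k then
    renormTime (iter (induction accelerated) (Nat.find h) (π, lam))
  else if h' : ∃ N, StopsAt (π, lam) N then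
    match conv with
    | .logIterations => ((Real.log (Nat.find h' : ℝ) : ℝ) : EReal)
    | .longestPath => renormTime (iter rauzyStep (Nat.find h') (π, lam))
  else ⊤

/-- Lebesgue measure on the hyperplane `∑ λ_α = 1`, in the coordinates `(λ_α)_{α ≠ β}`. -/
noncomputable def simplexLebesgue [Fintype A] [DecidableEq A] (β : A) : Measure (A → ℝ) :=
  Measure.map
    (fun (x : {α : A // α ≠ β} → ℝ) (α : A) =>
      if h : α ≠ β then x ⟨α, h⟩ else 1 - ∑ i, x i)
    volume

end Induction

end FIET

/-! Let q be the vector of column sums of the matrix of the moves made so far. The vectors λ > 0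
with ⟨q, λ⟩ < 1 form a cone of volume proportional to ∏ 1/q_α. A move preserves volume and carries
the part of this cone where it applies onto the cone of the updated q. Up to the null set of ties,
Rauzy induction thus becomes a random walk on pairs (π, q): the move with winner w and loser l has
probability q_l / (q_l + q_w) and replaces q_l by q_l + q_w. The walk stops at reducible π.

For both inductions and both conventions, r is at most the logarithm of the supremum of ∑ q along
the orbit (`exp_roof_le`). It therefore suffices to bound a small moment of ∑ q uniformly in the
number of moves (`exists_expSize_le`, `lintegral_cone_le`).

Flips make the walk stop: from every π with flips some path leads to a reducible permutation
(`of_flipped`). The quantitative form is `stopsFrom` with s = ∅: there are C and c > 0 such that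
from any weights of sum M, the sum ever exceeds CM with probability at most 1 - c. Each such passage
multiplies the sum by at most 2C, so the tails are geometric.

The difficulty is that a given path is unlikely when the weights have very different sizes. The
proof is an induction that enlarges a set s of letters with weights comparable to M. A move whose
loser is in s has probability bounded below. By Rauzy's rotation argument (`of_last_letter`) a
letter outside s can be brought to the end of a row. From there a martingale estimate
(`StopsFrom.of_winner_notMem`) shows that with positive probability the walk stops, or a weight
outside s becomes comparable to M, before the weights in s have grown much. -/

namespace FIET

/-! ### Rows, winners and losers under one move. -/

/-- The move with the roles of the two rows exchanged. -/
def Move.other : Move → Move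
  | .a => .b
  | .b => .a

@[simp] lemma Move.other_other (t : Move) : t.other.other = t := by cases t <;> rfl

lemma Move.forall_iff {p : Move → Prop} (t : Move) : (∀ s, p s) ↔ p t ∧ p t.other := by
  constructor
  · exact fun h => ⟨h _, h _⟩
  · rintro ⟨h, h'⟩ s
    cases t <;> cases s <;> assumption

lemma insertLast_of_lt {A : Type*} {n : ℕ} [NeZero n] (p : A ≃ Fin n) (w x : A) (c : Bool)
    (hw : (p w : ℕ) < n - 1) (hx : (p x : ℕ) < p w + (if c then 0 else 1)) :
    insertLast p w c x = p x := by
  simp only [insertLast, Equiv.trans_apply]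
  apply Fin.cycleIcc_of_lt
  rw [Fin.lt_def]
  cases c
  · simp only [Bool.false_eq_true, if_false] at hx ⊢
    -- Without `hw` the position `p w + 1` would wrap around to 0 in `Fin n`.
    rw [Fin.val_add_one_of_lt' (by omega)]
    exact hx
  · simpa using hx

lemma val_insertLast_of_ge {A : Type*} {n : ℕ} [NeZero n] (p : A ≃ Fin n) (w x : A) (c : Bool)
    (hx : (p w : ℕ) + (if c then 0 else 1) ≤ p x)
    (hx' : (p x : ℕ) < n - 1) :
    (insertLast p w c x : ℕ) = p x + 1 := by
  simp only [insertLast, Equiv.trans_apply]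
  rw [Fin.cycleIcc_of_ge_of_lt, Fin.val_add_one_of_lt' (by omega)]
  · rw [Fin.le_def]
    cases c
    · simp only [Bool.false_eq_true, if_false] at hx ⊢
      rw [Fin.val_add_one_of_lt' (by omega)]
      exact hx
    · simpa using hx
  · rw [Fin.lt_def]
    simpa [Fin.top_eq_last] using hx'

namespace GenPerm

variable {A : Type*} {n : ℕ} [NeZero n]

/-- The row in which the winner of the move is last. -/
def row (π : GenPerm A n) : Move → A ≃ Fin n
  | .a => π.top
  | .b => π.bot

lemma winner_eq (π : GenPerm A n) (t : Move) : π.winner t = (π.row t).symm ⊤ := by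
  cases t <;> rfl

lemma winner_other (π : GenPerm A n) (t : Move) : π.winner t.other = π.loser t := by
  cases t <;> rfl

lemma loser_other (π : GenPerm A n) (t : Move) : π.loser t.other = π.winner t := by
  cases t <;> rfl

lemma val_top : ((⊤ : Fin n) : ℕ) = n - 1 := by
  obtain ⟨m, rfl⟩ := Nat.exists_eq_succ_of_ne_zero (NeZero.ne n)
  simp [Fin.top_eq_last]

lemma row_winner (π : GenPerm A n) (t : Move) : (π.row t (π.winner t) : ℕ) = n - 1 := by
  rw [winner_eq, Equiv.apply_symm_apply, val_top]

lemma row_other_loser (π : GenPerm A n) (t : Move) :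
    (π.row t.other (π.loser t) : ℕ) = n - 1 := by
  rw [← winner_other, row_winner]

lemma eq_winner_of_row (π : GenPerm A n) (t : Move) (x : A) (h : (π.row t x : ℕ) = n - 1) :
    x = π.winner t := by
  rw [winner_eq, Equiv.eq_symm_apply]
  exact Fin.ext (h.trans val_top.symm)

lemma Irreducible.row_ne {π : GenPerm A n} (h : π.Irreducible) (t : Move) {k : ℕ} (hk : 1 ≤ k)
    (hk' : k < n) : {α : A | (π.row t α : ℕ) < k} ≠ {α : A | (π.row t.other α : ℕ) < k} := by
  cases t
  · exact h k hk hk'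
  · exact (h k hk hk').symm

/-- If the winner were last in both rows, the first n - 1 letters of the rows would form the same
set. -/
lemma Irreducible.row_other_winner_lt {π : GenPerm A n} (h : π.Irreducible) (hn : 2 ≤ n)
    (t : Move) : (π.row t.other (π.winner t) : ℕ) < n - 1 := by
  by_contra hlt
  have hw : (π.row t.other (π.winner t) : ℕ) = n - 1 := by
    have := (π.row t.other (π.winner t)).isLt
    omega
  refine h.row_ne t (k := n - 1) (by omega) (by omega) ?_
  ext α
  simp only [mem_ofPred_eq]
  have h1 := (π.row t α).isLt
  have h2 := (π.row t.other α).isLt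
  have e1 := eq_winner_of_row π t α
  have e2 := eq_winner_of_row π t.other α
  have e3 := eq_winner_of_row π t.other _ hw
  have e4 := row_winner π t
  constructor
  · intro h3
    by_contra h4
    rw [e2 (by omega), ← e3] at h3
    omega
  · intro h3
    by_contra h4
    rw [e1 (by omega)] at h3
    omega

lemma Irreducible.winner_ne_loser {π : GenPerm A n} (h : π.Irreducible) (hn : 2 ≤ n) (t : Move) :
    π.winner t ≠ π.loser t := by
  intro e
  have h1 := h.row_other_winner_lt hn t
  rw [e, row_other_loser] at h1
  omega

variable [DecidableEq A]

lemma row_move (π : GenPerm A n) (t : Move) : (π.move t).row t = π.row t := by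
  cases t <;> rfl

lemma row_other_move (π : GenPerm A n) (t : Move) : (π.move t).row t.other =
    insertLast (π.row t.other) (π.winner t) (π.flipped (π.winner t)) := by
  cases t <;> rfl

lemma winner_move (π : GenPerm A n) (t : Move) : (π.move t).winner t = π.winner t := by
  rw [winner_eq, winner_eq, row_move]

lemma flipped_move_of_ne_loser (π : GenPerm A n) (t : Move) {x : A} (hx : x ≠ π.loser t) :
    (π.move t).flipped x = π.flipped x := by
  simp [move, Function.update_of_ne hx]

lemma flipped_move_of_winner (π : GenPerm A n) (t : Move) {x : A}
    (hw : π.flipped (π.winner t) = false) : (π.move t).flipped x = π.flipped x := by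
  by_cases hx : x = π.loser t
  · subst hx
    simp [move, hw]
  · exact flipped_move_of_ne_loser π t hx

/-- A flipped winner keeps its flip, and an unflipped winner changes no flip. -/
lemma Irreducible.exists_flipped_move {π : GenPerm A n} (h : π.Irreducible) (hn : 2 ≤ n)
    (t : Move) (hF : ∃ α, π.flipped α = true) : ∃ α, (π.move t).flipped α = true := by
  by_cases hw : π.flipped (π.winner t) = true
  · exact ⟨_, by rw [flipped_move_of_ne_loser π t (h.winner_ne_loser hn t), hw]⟩
  · obtain ⟨x, hx⟩ := hF
    exact ⟨x, by rw [flipped_move_of_winner π t (by simpa using hw), hx]⟩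

/-! ### Paths to reducible permutations. -/

/-- A flipped last letter which wins sufficiently often becomes last in both rows. -/
lemma of_flipped_winner (hn : 2 ≤ n) {P : GenPerm A n → Prop}
    (hred : ∀ π, ¬ π.Irreducible → P π)
    (hmove : ∀ π t, π.Irreducible → P (π.move t) → P π) (t : Move) :
    ∀ (m : ℕ) (π : GenPerm A n), π.flipped (π.winner t) = true →
      n - 1 - (π.row t.other (π.winner t) : ℕ) = m → P π := by
  intro m
  induction m with
  | zero =>
    intro π _ hm
    refine hred π fun h => ?_
    have := h.row_other_winner_lt hn t
    omega
  | succ m ih =>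
    intro π hw hm
    by_cases h : π.Irreducible
    · refine hmove π t h (ih _ ?_ ?_)
      · rw [winner_move, flipped_move_of_ne_loser π t (h.winner_ne_loser hn t), hw]
      · have h1 := h.row_other_winner_lt hn t
        rw [winner_move, row_other_move, val_insertLast_of_ge _ _ _ _ (by simp [hw]) h1]
        omega
    · exact hred π h

/-- If a property is closed under the inverse moves and holds wherever the induction stops and
wherever a given letter is last in a row, then it always holds. -/
lemma of_last_letter (hn : 2 ≤ n) {P : GenPerm A n → Prop}
    (hred : ∀ π, ¬ π.Irreducible → P π)
    (hmove : ∀ π t, π.Irreducible → P (π.move t) → P π) (x : A)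
    (hx : ∀ π t, π.winner t = x → P π) (π : GenPerm A n) : P π := by
  by_contra hπ
  have hirr : ∀ π : GenPerm A n, ¬ P π → π.Irreducible := fun π h => by
    by_contra h'
    exact h (hred π h')
  have hbad : ∀ (π : GenPerm A n) t, ¬ P π → ¬ P (π.move t) := fun π t h h' =>
    h (hmove π t (hirr π h) h')
  have hunfl : ∀ (π : GenPerm A n) t, ¬ P π → π.flipped (π.winner t) = false := fun π t h => by
    by_contra h'
    exact h (of_flipped_winner hn hred hmove t _ π (by simpa using h') rfl)
  -- While an unflipped letter keeps winning, the part of the other row to its right rotates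
  -- cyclically and the rest of that row is fixed. Hence every letter on its right becomes last at
  -- some time.
  have hcyc : ∀ (t : Move) (y : A) (m : ℕ) (π : GenPerm A n), ¬ P π →
      (π.row t.other (π.winner t) : ℕ) < π.row t.other y → n - 1 - (π.row t.other y : ℕ) = m →
      ∃ π' : GenPerm A n, ¬ P π' ∧ π'.row t = π.row t ∧ π'.winner t.other = y ∧
        ∀ z, (π.row t.other z : ℕ) ≤ π.row t.other (π.winner t) →
          π'.row t.other z = π.row t.other z := by
    intro t y m
    induction m with
    | zero =>
      intro π h _ hm
      refine ⟨π, h, rfl, (eq_winner_of_row π _ y ?_).symm, fun _ _ => rfl⟩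
      have := (π.row t.other y).isLt
      omega
    | succ m ih =>
      intro π h hlt hm
      have h1 := (hirr π h).row_other_winner_lt hn t
      have hf := hunfl π t h
      have hz : ∀ z, (π.row t.other z : ℕ) ≤ π.row t.other (π.winner t) →
          (π.move t).row t.other z = π.row t.other z := fun z hz => by
        rw [row_other_move]
        exact insertLast_of_lt _ _ _ _ h1 (by simp [hf]; omega)
      have hy : ((π.move t).row t.other y : ℕ) = π.row t.other y + 1 := by
        rw [row_other_move]
        exact val_insertLast_of_ge _ _ _ _ (by simp [hf]; omega) (by omega)
      obtain ⟨π', h1', h2', h3', h4'⟩ := ih (π.move t) (hbad π t h)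
        (by rw [winner_move, hz _ le_rfl, hy]; omega) (by rw [hy]; omega)
      refine ⟨π', h1', h2'.trans (row_move π t), h3', fun z hz' => ?_⟩
      rw [h4' z, hz z hz']
      rw [winner_move, hz _ le_rfl, hz z hz']
      exact hz'
  -- Choose the bad vertex and the move for which the winner stands furthest left in the other row.
  -- Two rotations will produce a winner still further left.
  obtain ⟨v, t, hv, hmin⟩ : ∃ (v : GenPerm A n) (t : Move), ¬ P v ∧
      ∀ (v' : GenPerm A n) (t' : Move), ¬ P v' →
        (v.row t.other (v.winner t) : ℕ) ≤ v'.row t'.other (v'.winner t') := by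
    let f : {v : GenPerm A n // ¬ P v} × Move → ℕ := fun z =>
      (z.1.1.row z.2.other (z.1.1.winner z.2) : ℕ)
    obtain ⟨z, hz⟩ := (wellFounded_lt (α := ℕ)).has_min (range f) ⟨_, ⟨⟨π, hπ⟩, .a⟩, rfl⟩
    obtain ⟨⟨z', rfl⟩, hz⟩ := hz
    exact ⟨z'.1.1, z'.2, z'.1.2, fun v' t' hv' => not_lt.1 (hz _ ⟨(⟨v', hv'⟩, t'), rfl⟩)⟩
  set p : ℕ := (v.row t.other (v.winner t) : ℕ) with hp
  have hpn : p < n - 1 := (hirr v hv).row_other_winner_lt hn t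
  -- Otherwise `x` is the winner or can be rotated to the end. This also gives `1 ≤ p`, so that
  -- irreducibility applies with `k = p`.
  have hxp : (v.row t.other x : ℕ) < p := by
    by_contra hxp
    rcases (not_lt.1 hxp).eq_or_lt with h | h
    · have : v.winner t = x := (v.row t.other).injective (Fin.ext h)
      exact hv (hx v t this)
    · obtain ⟨v', h1, _, h3, _⟩ := hcyc t x _ v hv h rfl
      exact h1 (hx v' _ h3)
  obtain ⟨z, hz1, hz2⟩ : ∃ z, (v.row t.other z : ℕ) < p ∧ p ≤ (v.row t z : ℕ) := by
    by_contra hno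
    push Not at hno
    refine (hirr v hv).row_ne t (k := p) (by omega) (by omega) ?_
    have : Finite A := Finite.of_equiv _ v.top.symm
    have hcard : ∀ e : A ≃ Fin n, {α : A | (e α : ℕ) < p}.ncard = p := fun e => by
      have : {α : A | (e α : ℕ) < p} = e.symm '' {i : Fin n | (i : ℕ) < p} := by
        ext α
        simp
      rw [this, ncard_image_of_injective _ e.symm.injective, ← Nat.card_coe_set_eq]
      simp [Fin.card_filter_val_lt]
      omega
    symm
    exact eq_of_subset_of_ncard_le (fun α h => hno α h) (by rw [hcard, hcard])
      (toFinite _)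
  -- Counting: otherwise the letters at positions `≥ p` of the other row, and `z` in addition, would
  -- all stand at positions `≥ p` of the row `t`.
  obtain ⟨y, hy1, hy2⟩ : ∃ y, p < (v.row t.other y : ℕ) ∧ (v.row t y : ℕ) < v.row t z := by
    by_contra hno
    push Not at hno
    have hsub : (Finset.univ.filter fun i : Fin n => p ≤ (i : ℕ)).map
          (v.row t.other).symm.toEmbedding ⊂
        (Finset.univ.filter fun i : Fin n => p ≤ (i : ℕ)).map (v.row t).symm.toEmbedding := by
      rw [Finset.ssubset_iff_of_subset]
      · refine ⟨z, ?_, ?_⟩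
        · simpa [Finset.mem_map, Equiv.symm_apply_eq] using hz2
        · simpa [Finset.mem_map, Equiv.symm_apply_eq] using hz1
      · intro α hα
        simp only [Finset.mem_map, Finset.mem_filter, Finset.mem_univ, true_and,
          Equiv.coe_toEmbedding, Equiv.symm_apply_eq, exists_eq_right] at hα ⊢
        rcases hα.eq_or_lt with h | h
        · have : v.winner t = α := (v.row t.other).injective (Fin.ext h)
          rw [← this, row_winner]
          omega
        · exact hz2.trans (hno α h)
    simpa using Finset.card_lt_card hsub
  -- Rotate `y` to the end of the other row, then let `y` win until `z` is last in the row `t`. As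
  -- `z` stands left of `p` in the other row, this contradicts minimality.
  obtain ⟨v', h1', h2', h3', h4'⟩ := hcyc t y _ v hv hy1 rfl
  have hzy : (v'.row t.other.other (v'.winner t.other) : ℕ) < v'.row t.other.other z := by
    rw [h3', Move.other_other, h2']
    exact hy2
  obtain ⟨v'', h1'', h2'', h3'', -⟩ := hcyc t.other z _ v' h1' hzy rfl
  rw [Move.other_other] at h3''
  have := hmin v'' t h1''
  rw [h3'', h2'', h4' z hz1.le] at this
  omega

/-- From every generalized permutation with flips there is a path to a reducible one. -/
lemma of_flipped (hn : 2 ≤ n) {P : GenPerm A n → Prop}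
    (hred : ∀ π, ¬ π.Irreducible → P π)
    (hmove : ∀ π t, π.Irreducible → P (π.move t) → P π) (π : GenPerm A n)
    (hF : ∃ α, π.flipped α = true) : P π := by
  obtain ⟨x, hx⟩ := hF
  refine of_last_letter hn (P := fun π => π.flipped x = true → P π) (fun π h _ => hred π h)
    (fun π t h hP hxπ => ?_) x (fun π t ht hxπ => ?_) π hx
  · by_cases hw : π.flipped (π.winner t) = true
    · exact of_flipped_winner hn hred hmove t _ π hw rfl
    · exact hmove π t h (hP (by rw [flipped_move_of_winner π t (by simpa using hw), hxπ]))
  · exact of_flipped_winner hn hred hmove t _ π (by rw [ht, hxπ]) rfl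

end GenPerm

/-! ### The random walk of permutations and weights. -/

namespace GenPerm

variable {A : Type*} {n : ℕ} [NeZero n]

instance [Finite A] : Finite (GenPerm A n) :=
  Finite.of_injective (fun π : GenPerm A n => (π.top, π.bot, π.flipped)) fun π π' h => by
    simp only [Prod.mk.injEq] at h
    exact GenPerm.ext h.1 h.2.1 h.2.2

/-- The average of `f` over the two moves, where a move has a probability proportional to the
weight of its loser. -/
noncomputable def avg (π : GenPerm A n) (q : A → ℝ) (f : Move → ℝ) : ℝ :=
  (q (π.loser .a) * f .a + q (π.loser .b) * f .b) / (q (π.loser .a) + q (π.loser .b))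

lemma avg_eq (π : GenPerm A n) (q : A → ℝ) (f : Move → ℝ) (t : Move) :
    π.avg q f = (q (π.loser t) * f t + q (π.winner t) * f t.other) /
      (q (π.loser t) + q (π.winner t)) := by
  cases t
  · rfl
  · rw [avg, add_comm, add_comm (q (π.loser .a))]
    rfl

lemma avg_mono (π : GenPerm A n) {q : A → ℝ} (hq : ∀ α, 0 < q α) {f g : Move → ℝ}
    (h : ∀ t, f t ≤ g t) : π.avg q f ≤ π.avg q g := by
  have h1 := hq (π.loser .a)
  have h2 := hq (π.loser .b)
  unfold avg
  have h3 := h .a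
  have h4 := h .b
  gcongr

lemma avg_const (π : GenPerm A n) {q : A → ℝ} (hq : ∀ α, 0 < q α) (x : ℝ) :
    π.avg q (fun _ => x) = x := by
  have h1 := hq (π.loser .a)
  have h2 := hq (π.loser .b)
  unfold avg
  field_simp

lemma avg_add_mul (π : GenPerm A n) {q : A → ℝ} (hq : ∀ α, 0 < q α) (x y : ℝ) (f : Move → ℝ) :
    π.avg q (fun t => x + f t * y) = x + π.avg q f * y := by
  have h1 := hq (π.loser .a)
  have h2 := hq (π.loser .b)
  unfold avg
  field_simp
  ring

variable [DecidableEq A]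

/-- The action of a move on the column sums of the matrix of a path. -/
def push (π : GenPerm A n) (t : Move) (q : A → ℝ) : A → ℝ :=
  Function.update q (π.loser t) (q (π.winner t) + q (π.loser t))

lemma push_loser (π : GenPerm A n) (t : Move) (q : A → ℝ) :
    π.push t q (π.loser t) = q (π.winner t) + q (π.loser t) := by
  simp [push]

lemma push_of_ne (π : GenPerm A n) (t : Move) (q : A → ℝ) {x : A} (hx : x ≠ π.loser t) :
    π.push t q x = q x := by
  simp [push, hx]

lemma le_push (π : GenPerm A n) (t : Move) {q : A → ℝ} (hq : ∀ α, 0 < q α) (α : A) :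
    q α ≤ π.push t q α := by
  by_cases h : α = π.loser t
  · rw [h, push_loser]
    linarith [hq (π.winner t)]
  · rw [push_of_ne _ _ _ h]

lemma push_pos (π : GenPerm A n) (t : Move) {q : A → ℝ} (hq : ∀ α, 0 < q α) (α : A) :
    0 < π.push t q α :=
  (hq α).trans_le (le_push π t hq α)

lemma sum_push (π : GenPerm A n) (t : Move) (q : A → ℝ) (s : Finset A) (h : π.loser t ∈ s) :
    ∑ α ∈ s, π.push t q α = ∑ α ∈ s, q α + q (π.winner t) := by
  unfold push
  rw [Finset.sum_update_of_mem h, ← Finset.add_sum_erase s q h, Finset.sdiff_singleton_eq_erase]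
  ring

lemma sum_push_of_notMem (π : GenPerm A n) (t : Move) (q : A → ℝ) (s : Finset A)
    (h : π.loser t ∉ s) : ∑ α ∈ s, π.push t q α = ∑ α ∈ s, q α :=
  Finset.sum_congr rfl fun α hα => push_of_ne π t q fun e => h (e ▸ hα)

variable [Fintype A]

lemma sum_push_univ_le (π : GenPerm A n) (t : Move) {q : A → ℝ} (hq : ∀ α, 0 < q α) :
    ∑ α, π.push t q α ≤ 2 * ∑ α, q α := by
  rw [sum_push π t q _ (Finset.mem_univ _), two_mul]
  gcongr
  exact Finset.single_le_sum (fun α _ => (hq α).le) (Finset.mem_univ _)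

open Classical in
/-- The probability that the sum of the weights exceeds `T` within the given number of moves,
before the induction stops. -/
noncomputable def esc (T : ℝ) : ℕ → GenPerm A n → (A → ℝ) → ℝ
  | 0, _, q => if T < ∑ α, q α then 1 else 0
  | N + 1, π, q => if T < ∑ α, q α then 1
      else if π.Irreducible then π.avg q fun t => esc T N (π.move t) (π.push t q) else 0

lemma esc_of_not_irreducible {T : ℝ} {π : GenPerm A n} {q : A → ℝ} (hT : ∑ α, q α ≤ T)
    (h : ¬ π.Irreducible) (N : ℕ) : esc T N π q = 0 := by
  cases N <;> simp [esc, hT.not_gt, h]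

lemma esc_zero {T : ℝ} {π : GenPerm A n} {q : A → ℝ} (hT : ∑ α, q α ≤ T) :
    esc T 0 π q = 0 := by
  simp [esc, hT.not_gt]

lemma esc_succ {T : ℝ} {π : GenPerm A n} {q : A → ℝ} (hT : ∑ α, q α ≤ T)
    (h : π.Irreducible) (N : ℕ) :
    esc T (N + 1) π q = π.avg q fun t => esc T N (π.move t) (π.push t q) := by
  simp [esc, hT.not_gt, h]

lemma esc_of_lt {T : ℝ} (π : GenPerm A n) {q : A → ℝ} (hT : T < ∑ α, q α) (N : ℕ) :
    esc T N π q = 1 := by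
  cases N <;> simp [esc, hT]

lemma esc_le_one (T : ℝ) (N : ℕ) : ∀ (π : GenPerm A n) (q : A → ℝ), (∀ α, 0 < q α) →
    esc T N π q ≤ 1 := by
  induction N with
  | zero =>
    intro π q _
    unfold esc
    split_ifs <;> norm_num
  | succ N ih =>
    intro π q hq
    rcases lt_or_ge T (∑ α, q α) with hT | hT
    · rw [esc_of_lt _ hT]
    by_cases h : π.Irreducible
    · rw [esc_succ hT h]
      exact (avg_mono π hq fun t => ih _ _ (push_pos π t hq)).trans (avg_const π hq 1).le
    · rw [esc_of_not_irreducible hT h]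
      norm_num

/-! ### Uniform lower bounds for the probability of stopping. -/

/-- Uniformly in the weights `q` of sum at most `M` that are at least `ε * M` on `s`, the induction
stops with positive probability before the sum of the weights exceeds a multiple of `M`. -/
def StopsUniformly (s : Finset A) (ε C c : ℝ) (π : GenPerm A n) : Prop :=
  ∀ (q : A → ℝ) (M : ℝ), (∀ α, 0 < q α) → ∑ α, q α ≤ M → (∀ α ∈ s, ε * M ≤ q α) →
    ∀ T, C * M ≤ T → ∀ N, esc T N π q ≤ 1 - c

/-- The property `StopsUniformly` with constants depending on the lower bound `ε`. -/
def StopsFrom (s : Finset A) (π : GenPerm A n) : Prop :=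
  ∀ ε > 0, ∃ C c : ℝ, 1 ≤ C ∧ 0 < c ∧ c ≤ 1 ∧ StopsUniformly s ε C c π

lemma sum_pos_of_pos (π : GenPerm A n) {q : A → ℝ} (hq : ∀ α, 0 < q α) : 0 < ∑ α, q α :=
  Finset.sum_pos (fun α _ => hq α) ⟨π.top.symm ⊤, Finset.mem_univ _⟩

lemma StopsUniformly.mono {s : Finset A} {ε C C' c c' : ℝ} {π : GenPerm A n}
    (h : StopsUniformly s ε C c π) (hC : C ≤ C') (hc : c' ≤ c) :
    StopsUniformly s ε C' c' π := fun q M hq hM hs T hT N => by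
  have hM0 : 0 ≤ M := (sum_pos_of_pos π hq).le.trans hM
  linarith [h q M hq hM hs T ((mul_le_mul_of_nonneg_right hC hM0).trans hT) N]

lemma StopsFrom.of_not_irreducible (s : Finset A) {π : GenPerm A n} (h : ¬ π.Irreducible) :
    StopsFrom s π := fun ε _ => ⟨1, 1, le_rfl, one_pos, le_rfl, fun q M hq hM _ T hT N => by
  rw [esc_of_not_irreducible (by linarith) h]
  norm_num⟩

/-- A loser of weight at least εM gives the move a probability of at least ε/2. The sum at most
doubles, so M becomes 2M and ε becomes ε/2, which leaves the lower bound εM unchanged. -/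
lemma StopsFrom.of_move {s : Finset A} {π : GenPerm A n} (hπ : π.Irreducible) (t : Move)
    (hl : π.loser t ∈ s) (h : StopsFrom s (π.move t)) : StopsFrom s π := fun ε hε => by
  obtain ⟨C, c, hC, hc, hc1, hs⟩ := h (ε / 2) (by positivity)
  refine ⟨2 * C, min (ε / 2) 1 * c, by linarith, by positivity,
    mul_le_one₀ (min_le_right _ _) hc.le hc1, fun q M hq hM hqs T hT N => ?_⟩
  have hM0 : 0 < M := (sum_pos_of_pos π hq).trans_le hM
  have hle : min (ε / 2) 1 * c ≤ 1 := mul_le_one₀ (min_le_right _ _) hc.le hc1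
  have hTM : ∑ α, q α ≤ T := by nlinarith
  cases N with
  | zero =>
    rw [esc_zero hTM]
    linarith
  | succ N =>
    rw [esc_succ hTM hπ, avg_eq _ _ _ t]
    have h1 := hs (π.push t q) (2 * M) (push_pos π t hq)
      ((sum_push_univ_le π t hq).trans (by linarith))
      (fun α hα => le_trans (by linarith [hqs α hα]) (le_push π t hq α)) T (by linarith) N
    have h2 := esc_le_one T N (π.move t.other) _ (push_pos π t.other hq)
    have hl0 := hq (π.loser t)
    have hw0 := hq (π.winner t)
    rw [div_le_iff₀ (by linarith)]
    have hsingle : ∀ α, q α ≤ M := fun α =>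
      (Finset.single_le_sum (fun α _ => (hq α).le) (Finset.mem_univ α)).trans hM
    have h3 : ε / 2 * (q (π.loser t) + q (π.winner t)) ≤ q (π.loser t) := by
      have := hqs _ hl
      nlinarith [hsingle (π.loser t), hsingle (π.winner t)]
    have h4 : min (ε / 2) 1 * (q (π.loser t) + q (π.winner t)) ≤ q (π.loser t) :=
      le_trans (by gcongr; exact min_le_left _ _) h3
    nlinarith

lemma exists_uniform {ι : Type*} [Finite ι] (s : ι → Finset A) (π : ι → GenPerm A n) (ε : ℝ)
    (hε : 0 < ε) (h : ∀ i, StopsFrom (s i) (π i)) :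
    ∃ C c : ℝ, 1 ≤ C ∧ 0 < c ∧ c ≤ 1 ∧ ∀ i, StopsUniformly (s i) ε C c (π i) := by
  choose C c hC hc hc1 hs using fun i => h i ε hε
  obtain ⟨C', hC'⟩ := (finite_range C).bddAbove
  obtain ⟨D, hD⟩ := (finite_range fun i => (c i)⁻¹).bddAbove
  refine ⟨max C' 1, (max D 1)⁻¹, le_max_right _ _, by positivity,
    inv_le_one_of_one_le₀ (le_max_right _ _), fun i =>
      (hs i).mono ((hC' ⟨i, rfl⟩).trans (le_max_left _ _)) ?_⟩
  rw [inv_le_comm₀ (by positivity) (hc i)]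
  exact (hD ⟨i, rfl⟩).trans (le_max_left _ _)

/-- The bound used while a letter outside `s` is last in one of the rows: such a letter stays
there until a letter of `s` wins against it, and until then the weights of the letters in `s` form
a martingale. -/
lemma StopsFrom.of_winner_notMem (hn : 2 ≤ n) {s : Finset A}
    (h : ∀ x ∉ s, ∀ π : GenPerm A n, (∃ α, π.flipped α = true) → StopsFrom (insert x s) π)
    {π : GenPerm A n} (hπ : ∃ α, π.flipped α = true) (hw : ∃ t, π.winner t ∉ s) :
    StopsFrom s π := fun ε hε => by
  -- Total weight in units of M when the letters in `s` have sum at most 2M and each other letter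
  -- weighs at most (2 + 2ε)M. The threshold ε/B relative to BM is again εM.
  set B : ℝ := 2 + Fintype.card A * (2 + 2 * ε) with hB
  have hB2 : 2 ≤ B := by
    have : 0 ≤ Fintype.card A * (2 + 2 * ε) := by positivity
    linarith
  obtain ⟨C, c, hC, hc, hc1, hs⟩ := exists_uniform
    (ι := {z : A × GenPerm A n // z.1 ∉ s ∧ ∃ α, z.2.flipped α = true})
    (fun z => insert z.1.1 s) (fun z => z.1.2) (ε / B) (by positivity)
    (fun z => h _ z.2.1 _ z.2.2)
  refine ⟨C * B, c / 2, by nlinarith, by positivity, by linarith, fun q₀ M hq₀ hM hqs₀ T hT => ?_⟩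
  have hM0 : 0 < M := (sum_pos_of_pos π hq₀).trans_le hM
  have hBM : B * M ≤ T := by
    have : 0 < B * M := mul_pos (by linarith) hM0
    nlinarith
  have hsum : ∀ q : A → ℝ, ∑ α ∈ s, q α ≤ 2 * M → (∀ α ∉ s, q α ≤ (2 + 2 * ε) * M) →
      ∑ α, q α ≤ B * M := by
    intro q h1 h2
    rw [← Finset.sum_add_sum_compl s, hB, add_mul]
    gcongr
    refine (Finset.sum_le_card_nsmul _ _ _ fun α hα => h2 α (by simpa using hα)).trans ?_
    rw [nsmul_eq_mul, mul_assoc]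
    gcongr
    exact Finset.card_le_univ _
  have hbig : ∀ (N : ℕ) (π : GenPerm A n) (q : A → ℝ), (∃ α, π.flipped α = true) →
      (∀ α, 0 < q α) → (∀ α ∈ s, ε * M ≤ q α) → ∑ α ∈ s, q α ≤ 2 * M →
      (∀ α ∉ s, q α ≤ (2 + 2 * ε) * M) → (∃ x, x ∉ s ∧ ε * M ≤ q x) → esc T N π q ≤ 1 - c := by
    intro N π q hF hq hqs h1 h2 ⟨x, hx, hqx⟩
    refine hs ⟨(x, π), hx, hF⟩ q (B * M) hq (hsum q h1 h2) (fun α hα => ?_) T (by linarith) N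
    have : ε / B * (B * M) = ε * M := by field_simp
    rw [this]
    rcases Finset.mem_insert.1 hα with rfl | hα
    · exact hqx
    · exact hqs α hα
  -- The last term is at least c once the sum over `s` exceeds 2M, where the trivial bound 1
  -- suffices, and is at most c/2 at the start. Once a weight outside `s` reaches εM, `hbig`
  -- applies.
  have key : ∀ (N : ℕ) (π : GenPerm A n) (q : A → ℝ), (∃ α, π.flipped α = true) →
      (∀ α, 0 < q α) → (∀ α ∈ s, ε * M ≤ q α) → (∀ α ∉ s, q α ≤ (2 + 2 * ε) * M) →
      ((∃ x, x ∉ s ∧ ε * M ≤ q x) ∨ ∃ t, π.winner t ∉ s) →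
      esc T N π q ≤ 1 - c + (∑ α ∈ s, q α) * (c / (2 * M)) := by
    intro N
    induction N with
    | zero =>
      intro π q _ hq _ h2 _
      have h0 : 0 ≤ ∑ α ∈ s, q α := Finset.sum_nonneg fun α _ => (hq α).le
      rcases le_or_gt (∑ α ∈ s, q α) (2 * M) with h1 | h1
      · rw [esc_zero ((hsum q h1 h2).trans hBM)]
        have : 0 ≤ (∑ α ∈ s, q α) * (c / (2 * M)) := by positivity
        linarith
      · refine (esc_le_one _ _ _ _ hq).trans ?_
        have : 2 * M * (c / (2 * M)) ≤ (∑ α ∈ s, q α) * (c / (2 * M)) := by gcongr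
        have e : 2 * M * (c / (2 * M)) = c := by field_simp
        linarith
    | succ N ih =>
      intro π q hF hq hqs h2 hor
      have h0 : 0 ≤ ∑ α ∈ s, q α := Finset.sum_nonneg fun α _ => (hq α).le
      have hpos : 0 ≤ (∑ α ∈ s, q α) * (c / (2 * M)) := by positivity
      rcases lt_or_ge (2 * M) (∑ α ∈ s, q α) with h1 | h1
      · refine (esc_le_one _ _ _ _ hq).trans ?_
        have : 2 * M * (c / (2 * M)) ≤ (∑ α ∈ s, q α) * (c / (2 * M)) := by gcongr
        have e : 2 * M * (c / (2 * M)) = c := by field_simp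
        linarith
      by_cases hx : ∃ x, x ∉ s ∧ ε * M ≤ q x
      · linarith [hbig (N + 1) π q hF hq hqs h1 h2 hx]
      have hsmall : ∀ x ∉ s, q x < ε * M := by
        push Not at hx
        exact hx
      obtain ⟨t, ht⟩ := hor.resolve_left hx
      have hT' := (hsum q h1 h2).trans hBM
      by_cases hirr : π.Irreducible
      swap
      · rw [esc_of_not_irreducible hT' hirr]
        linarith
      rw [esc_succ hT' hirr]
      have hwin : ∀ t, π.winner t ∉ s →
          esc T N (π.move t) (π.push t q) ≤
            1 - c + (∑ α ∈ s, π.push t q α) * (c / (2 * M)) := fun t ht =>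
        ih _ _ (hirr.exists_flipped_move hn t hF) (push_pos π t hq)
          (fun α hα => (hqs α hα).trans (le_push π t hq α))
          (fun α hα => by
            by_cases hαl : α = π.loser t
            · have e1 := hsmall _ ht
              have e2 := hsmall α hα
              rw [hαl] at e2 ⊢
              rw [push_loser]
              linarith
            · rw [push_of_ne _ _ _ hαl]
              exact h2 α hα)
          (.inr ⟨t, by rwa [winner_move]⟩)
      -- If the loser l is in `s`, then either the sum over `s` grows by q_w, or w reaches weight εM
      -- and the bound drops to 1 - c. The average does not exceed the claimed bound because q_l is
      -- at most the sum over `s`.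
      by_cases hl : π.loser t ∈ s
      · have h3 : esc T N (π.move t.other) (π.push t.other q) ≤ 1 - c := by
          have hno : π.loser t.other ∉ s := by rwa [loser_other]
          refine hbig N _ _ (hirr.exists_flipped_move hn _ hF) (push_pos π _ hq)
            (fun α hα => (hqs α hα).trans (le_push π _ hq α))
            (by rwa [sum_push_of_notMem π _ _ _ hno])
            (fun α hα => ?_) ⟨_, hno, ?_⟩
          · by_cases hαl : α = π.loser t.other
            · subst hαl
              rw [push_loser, winner_other]
              have e1 : q (π.loser t) ≤ ∑ α ∈ s, q α :=
                Finset.single_le_sum (fun α _ => (hq α).le) hl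
              have e2 := hsmall _ hα
              nlinarith
            · rw [push_of_ne _ _ _ hαl]
              exact h2 α hα
          · rw [push_loser, winner_other]
            linarith [hqs _ hl, hq (π.loser t.other)]
        have h4 := hwin t ht
        rw [sum_push π t q s hl] at h4
        rw [avg_eq _ _ _ t]
        have hl0 := hq (π.loser t)
        have hw0 := hq (π.winner t)
        have e1 : q (π.loser t) ≤ ∑ α ∈ s, q α :=
          Finset.single_le_sum (fun α _ => (hq α).le) hl
        rw [div_le_iff₀ (by linarith)]
        have hk : 0 < c / (2 * M) := by positivity
        have e2 := mul_le_mul_of_nonneg_left h4 hl0.le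
        have e3 := mul_le_mul_of_nonneg_left h3 hw0.le
        have e4 := mul_le_mul_of_nonneg_left e1 (mul_pos hw0 hk).le
        nlinarith
      · have : ∀ t', esc T N (π.move t') (π.push t' q) ≤
            1 - c + (∑ α ∈ s, q α) * (c / (2 * M)) := by
          rw [Move.forall_iff t]
          constructor
          · have h4 := hwin t ht
            rwa [sum_push_of_notMem π t q s hl] at h4
          · have h4 := hwin t.other (by rwa [winner_other])
            rwa [sum_push_of_notMem π t.other q s (by rwa [loser_other])] at h4
        exact (avg_mono π hq this).trans (avg_const π hq _).le
  intro N
  have hle : ∀ α, q₀ α ≤ M := fun α =>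
    (Finset.single_le_sum (fun α _ => (hq₀ α).le) (Finset.mem_univ α)).trans hM
  refine (key N π q₀ hπ hq₀ hqs₀ (fun α _ => (hle α).trans (by nlinarith)) (.inr hw)).trans ?_
  have h1 : ∑ α ∈ s, q₀ α ≤ M :=
    (Finset.sum_le_sum_of_subset_of_nonneg (Finset.subset_univ s) fun α _ _ => (hq₀ α).le).trans hM
  have h2 : (∑ α ∈ s, q₀ α) * (c / (2 * M)) ≤ M * (c / (2 * M)) := by gcongr
  have h3 : M * (c / (2 * M)) = c / 2 := by field_simp
  linarith

/-- Induction on the number of letters outside `s`. If there are none, every move has a loser in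
`s`, and the path to a reducible permutation can be followed backwards with `StopsFrom.of_move`.
Otherwise one goes back along a path that brings a letter outside `s` to the end of a row. -/
lemma stopsFrom (hn : 2 ≤ n) (s : Finset A) (π : GenPerm A n)
    (hπ : ∃ α, π.flipped α = true) : StopsFrom s π := by
  induction hk : sᶜ.card generalizing s π with
  | zero =>
    rw [Finset.card_eq_zero, Finset.compl_eq_empty_iff] at hk
    subst hk
    exact of_flipped hn (fun π h => .of_not_irreducible _ h)
      (fun π t h hP => .of_move h t (Finset.mem_univ _) hP) π hπ
  | succ k ih =>
    have hins : ∀ x ∉ s, ∀ π : GenPerm A n, (∃ α, π.flipped α = true) →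
        StopsFrom (insert x s) π := fun x hx π hπ => ih _ π hπ (by
      rw [Finset.compl_insert, Finset.card_erase_of_mem (by simpa using hx), hk]
      rfl)
    obtain ⟨x, hx⟩ : sᶜ.Nonempty := by
      rw [← Finset.card_pos]
      omega
    rw [Finset.mem_compl] at hx
    refine of_last_letter hn (P := fun π => (∃ α, π.flipped α = true) → StopsFrom s π)
      (fun π h _ => .of_not_irreducible _ h) (fun π t h hP hF => ?_) x (fun π t ht hF => ?_) π hπ
    · by_cases hl : π.loser t ∈ s
      · exact .of_move h t hl (hP (h.exists_flipped_move hn t hF))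
      · exact .of_winner_notMem hn hins hF ⟨t.other, by rwa [winner_other]⟩
    · exact .of_winner_notMem hn hins hF ⟨t, by rwa [ht]⟩

/-! ### Moments of the sum of the weights. -/

open Classical in
/-- The expected value of the `σ`-th power of the sum of the weights after the given number of
moves, or when the induction stops. -/
noncomputable def expSize (σ : ℝ) : ℕ → GenPerm A n → (A → ℝ) → ℝ
  | 0, _, q => (∑ α, q α) ^ σ
  | N + 1, π, q => if π.Irreducible then π.avg q fun t => expSize σ N (π.move t) (π.push t q)
      else (∑ α, q α) ^ σ

/-- Stop the walk when the sum first exceeds T. It is then at most 2T, since a move at most doubles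
it, and the bound for fewer moves applies. The alternative `m < N` records that a move has been
made. -/
lemma expSize_le_of_forall_lt (hn : 2 ≤ n) {σ K T : ℝ} (hσ : 0 < σ) (hK : 0 ≤ K) (hT : 0 < T)
    {N : ℕ} (hN : ∀ m < N, ∀ (π : GenPerm A n) (q : A → ℝ), (∃ α, π.flipped α = true) →
      (∀ α, 0 < q α) → expSize σ m π q ≤ K * (∑ α, q α) ^ σ) :
    ∀ m ≤ N, ∀ (π : GenPerm A n) (q : A → ℝ), (∃ α, π.flipped α = true) →
      (∀ α, 0 < q α) → ∑ α, q α ≤ 2 * T → (∑ α, q α ≤ T ∨ m < N) →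
      expSize σ m π q ≤ T ^ σ + esc T m π q * ((2 * T) ^ σ * K) := by
  have hexit : ∀ m < N, ∀ (π : GenPerm A n) (q : A → ℝ), (∃ α, π.flipped α = true) →
      (∀ α, 0 < q α) → ∑ α, q α ≤ 2 * T → T < ∑ α, q α →
      expSize σ m π q ≤ T ^ σ + esc T m π q * ((2 * T) ^ σ * K) := by
    intro m hm π q hF hq h1 h2
    rw [esc_of_lt _ h2, one_mul]
    refine (hN m hm π q hF hq).trans ?_
    have : (∑ α, q α) ^ σ ≤ (2 * T) ^ σ :=
      Real.rpow_le_rpow (hT.trans h2).le h1 hσ.le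
    have h3 : 0 ≤ T ^ σ := by positivity
    nlinarith
  intro m
  induction m with
  | zero =>
    intro _ π q hF hq h1 hor
    rcases le_or_gt (∑ α, q α) T with h | h
    · rw [esc_zero h, expSize, zero_mul, add_zero]
      exact Real.rpow_le_rpow (sum_pos_of_pos π hq).le h hσ.le
    · exact hexit 0 (hor.resolve_left h.not_ge) π q hF hq h1 h
  | succ m ih =>
    intro hm π q hF hq h1 hor
    rcases le_or_gt (∑ α, q α) T with h | h
    · by_cases hirr : π.Irreducible
      · rw [esc_succ h hirr, expSize, if_pos hirr, ← avg_add_mul π hq]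
        exact avg_mono π hq fun t => ih (by omega) _ _ (hirr.exists_flipped_move hn t hF)
          (push_pos π t hq) ((sum_push_univ_le π t hq).trans (by linarith)) (.inr (by omega))
      · rw [esc_of_not_irreducible h hirr, expSize, if_neg hirr, zero_mul, add_zero]
        exact Real.rpow_le_rpow (sum_pos_of_pos π hq).le h hσ.le
    · exact hexit _ (hor.resolve_left h.not_ge) π q hF hq h1 h

/-- Exponential tails for the chain of permutations and weights. -/
lemma exists_expSize_le (hn : 2 ≤ n) : ∃ σ K : ℝ, 0 < σ ∧ ∀ (N : ℕ) (π : GenPerm A n)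
    (q : A → ℝ), (∃ α, π.flipped α = true) → (∀ α, 0 < q α) →
    expSize σ N π q ≤ K * (∑ α, q α) ^ σ := by
  obtain ⟨C, c, hC, hc, hc1, hs⟩ := exists_uniform
    (ι := {π : GenPerm A n // ∃ α, π.flipped α = true}) (fun _ => ∅) (fun π => π.1) 1 one_pos
    (fun π => stopsFrom hn ∅ _ π.2)
  -- At σ = 0 the left side is 1 - c, so the strict inequality persists for small σ > 0.
  obtain ⟨σ, hσ, hσ'⟩ : ∃ σ : ℝ, (1 - c) * (2 * C) ^ σ < 1 - c / 2 ∧ 0 < σ := by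
    have hcont : ContinuousAt (fun σ : ℝ => (1 - c) * (2 * C) ^ σ) 0 :=
      continuousAt_const.mul (Real.continuousAt_const_rpow (by positivity))
    have hev := hcont.tendsto.eventually_lt_const (u := 1 - c / 2)
      (by rw [Real.rpow_zero]; linarith)
    exact ((hev.filter_mono nhdsWithin_le_nhds).and
      (self_mem_nhdsWithin : Ioi (0 : ℝ) ∈ nhdsWithin 0 (Ioi 0))).exists
  -- This K solves C^σ + (1 - c/2) K = K, so the induction on `N` reproduces the same constant.
  refine ⟨σ, C ^ σ / (c / 2), hσ', fun N => ?_⟩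
  have hK : 0 ≤ C ^ σ / (c / 2) := by positivity
  induction N using Nat.strong_induction_on with
  | _ N ih =>
    intro π q hF hq
    have hS := sum_pos_of_pos π hq
    set S := ∑ α, q α with hSdef
    have hle : S ≤ C * S := by nlinarith
    have h1 := expSize_le_of_forall_lt hn hσ' hK (by positivity : 0 < C * S) ih N le_rfl π q hF hq
      (by linarith) (.inl hle)
    have h2 := hs ⟨π, hF⟩ q S hq le_rfl (by simp) (C * S) le_rfl N
    refine h1.trans ?_
    have e1 : (C * S) ^ σ = C ^ σ * S ^ σ := Real.mul_rpow (by positivity) hS.le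
    have e2 : (2 * (C * S)) ^ σ = (2 * C) ^ σ * S ^ σ := by
      rw [← mul_assoc, Real.mul_rpow (by positivity) hS.le]
    rw [e1, e2]
    have hSσ : 0 < S ^ σ := by positivity
    have h2C : 0 < (2 * C) ^ σ := by positivity
    have e3 : esc (C * S) N π q * ((2 * C) ^ σ * S ^ σ * (C ^ σ / (c / 2))) ≤
        (1 - c) * ((2 * C) ^ σ * S ^ σ * (C ^ σ / (c / 2))) := by gcongr
    have e4 : (1 - c) * ((2 * C) ^ σ * S ^ σ * (C ^ σ / (c / 2))) ≤
        (1 - c / 2) * (S ^ σ * (C ^ σ / (c / 2))) := by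
      have : 0 ≤ S ^ σ * (C ^ σ / (c / 2)) := by positivity
      nlinarith
    have e5 : C ^ σ = (C ^ σ / (c / 2)) * (c / 2) := by field_simp
    nlinarith

end GenPerm

/-! ### Iterates of the plain and the accelerated induction. -/

lemma iter_succ_eq_bind {X : Type*} (F : X → Option X) (k : ℕ) (x : X) :
    iter F (k + 1) x = (F x).bind (iter F k) := by
  induction k with
  | zero => simp [iter]
  | succ k ih =>
    rw [iter, ih, Option.bind_assoc]
    rfl

lemma iter_add {X : Type*} (F : X → Option X) (j k : ℕ) (x : X) :
    iter F (j + k) x = (iter F j x).bind (iter F k) := by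
  induction k with
  | zero => simp [iter]
  | succ k ih =>
    rw [← add_assoc, iter, ih, Option.bind_assoc]
    rfl

section Orbits

variable {A : Type*} {n : ℕ} [NeZero n] [DecidableEq A]

lemma exists_iter_rauzyStep_of_induction (accelerated : Bool) {x y : Data A n}
    (h : induction accelerated x = some y) : ∃ m, iter rauzyStep m x = some y := by
  cases accelerated
  · exact ⟨1, by simpa [iter, induction] using h⟩
  · simp only [induction, if_true, zorichStep] at h
    split_ifs at h
    exact ⟨_, h⟩

lemma exists_iter_rauzyStep_of_iter (accelerated : Bool) (k : ℕ) :
    ∀ {x y : Data A n}, iter (induction accelerated) k x = some y →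
      ∃ m, iter rauzyStep m x = some y := by
  induction k with
  | zero => exact fun h => ⟨0, h⟩
  | succ k ih =>
    intro x y h
    rw [iter, Option.bind_eq_some_iff] at h
    obtain ⟨z, hz, hy⟩ := h
    obtain ⟨m, hm⟩ := ih hz
    obtain ⟨m', hm'⟩ := exists_iter_rauzyStep_of_induction accelerated hy
    exact ⟨m + m', by rw [iter_add, hm, Option.bind_some, hm']⟩

lemma exists_iter_of_forall_not_stopsAt {x : Data A n} (h : ∀ N, ¬ StopsAt x N) (N : ℕ) :
    ∃ y, iter rauzyStep N x = some y := by
  induction N with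
  | zero => exact ⟨x, rfl⟩
  | succ N ih =>
    obtain ⟨y, hy⟩ := ih
    have := h N
    simp only [StopsAt, not_exists, not_and] at this
    obtain ⟨z, hz⟩ := Option.ne_none_iff_exists'.1 (this y hy)
    exact ⟨z, by rw [iter, hy, Option.bind_some, hz]⟩

lemma rauzyType_eq_some_iff (π : GenPerm A n) (lam : A → ℝ) (t : Move) :
    rauzyType (π, lam) = some t ↔ π.Irreducible ∧ lam (π.loser t) < lam (π.winner t) := by
  unfold rauzyType
  by_cases h : π.Irreducible
  · simp only [h, if_true, true_and]
    cases t <;> simp only [GenPerm.loser, GenPerm.winner] <;> split_ifs with h1 h2 <;>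
      simp_all [le_of_lt]
  · simp [h]

end Orbits

/-! ### Weights along an orbit and the bound for the roof function. -/

namespace GenPerm

variable {A : Type*} {n : ℕ} [NeZero n] [DecidableEq A]

/-- The lengths after a move of Rauzy induction. -/
def nextLengths (π : GenPerm A n) (t : Move) (lam : A → ℝ) : A → ℝ :=
  Function.update lam (π.winner t) (lam (π.winner t) - lam (π.loser t))

lemma rauzyStep_eq_map (π : GenPerm A n) (lam : A → ℝ) : rauzyStep (π, lam) =
    (rauzyType (π, lam)).map fun t => (π.move t, π.nextLengths t lam) := rfl

lemma nextLengths_pos {π : GenPerm A n} {t : Move} {lam : A → ℝ} (h : ∀ α, 0 < lam α)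
    (hlt : lam (π.loser t) < lam (π.winner t)) (α : A) : 0 < π.nextLengths t lam α := by
  unfold nextLengths
  by_cases hα : α = π.winner t
  · subst hα
    simpa using hlt
  · simpa [hα] using h α

lemma nextLengths_smul (π : GenPerm A n) (t : Move) (c : ℝ) (lam : A → ℝ) :
    π.nextLengths t (c • lam) = c • π.nextLengths t lam := by
  ext α
  by_cases hα : α = π.winner t
  · subst hα
    simp [nextLengths, mul_sub]
  · simp [nextLengths, hα]

/-- The weights after `N` moves of Rauzy induction, or when the induction stops. -/
noncomputable def weightAfter : ℕ → GenPerm A n → (A → ℝ) → (A → ℝ) → A → ℝ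
  | 0, _, q, _ => q
  | N + 1, π, q, lam =>
    match rauzyType (π, lam) with
    | none => q
    | some t => weightAfter N (π.move t) (π.push t q) (π.nextLengths t lam)

lemma weightAfter_of_none {π : GenPerm A n} {lam : A → ℝ} (h : rauzyType (π, lam) = none) (N : ℕ)
    (q : A → ℝ) : weightAfter N π q lam = q := by
  cases N <;> simp [weightAfter, h]

lemma weightAfter_succ {π : GenPerm A n} {lam : A → ℝ} {t : Move}
    (h : rauzyType (π, lam) = some t) (N : ℕ) (q : A → ℝ) : weightAfter (N + 1) π q lam =
      weightAfter N (π.move t) (π.push t q) (π.nextLengths t lam) := by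
  simp [weightAfter, h]

lemma weightAfter_smul {c : ℝ} (hc : 0 < c) (N : ℕ) : ∀ (π : GenPerm A n) (q lam : A → ℝ),
    weightAfter N π q (c • lam) = weightAfter N π q lam := by
  induction N with
  | zero => exact fun _ _ _ => rfl
  | succ N ih =>
    intro π q lam
    have ht : rauzyType (π, c • lam) = rauzyType (π, lam) :=
      Option.ext fun t => by simp [rauzyType_eq_some_iff, hc]
    unfold weightAfter
    rw [ht]
    cases rauzyType (π, lam) with
    | none => rfl
    | some t =>
      simp only
      rw [nextLengths_smul, ih]

lemma weightAfter_pos (N : ℕ) : ∀ (π : GenPerm A n) (q lam : A → ℝ), (∀ α, 0 < q α) →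
    ∀ α, 0 < weightAfter N π q lam α := by
  induction N with
  | zero => exact fun _ _ _ h => h
  | succ N ih =>
    intro π q lam hq
    cases h : rauzyType (π, lam) with
    | none => rwa [weightAfter_of_none h]
    | some t =>
      rw [weightAfter_succ h]
      exact ih _ _ _ (push_pos π t hq)

variable [Fintype A]

/-- Column sums are multiplied by the matrix of the move and lengths by its inverse, so their
pairing is invariant. -/
lemma sum_push_mul_nextLengths {π : GenPerm A n} {t : Move} (h : π.winner t ≠ π.loser t)
    (q lam : A → ℝ) :
    ∑ α, π.push t q α * π.nextLengths t lam α = ∑ α, q α * lam α := by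
  have hl : π.loser t ∈ Finset.univ.erase (π.winner t) :=
    Finset.mem_erase.2 ⟨h.symm, Finset.mem_univ _⟩
  rw [← Finset.add_sum_erase _ _ (Finset.mem_univ (π.winner t)), ← Finset.add_sum_erase _ _ hl,
    ← Finset.add_sum_erase _ (fun α => q α * lam α) (Finset.mem_univ (π.winner t)),
    ← Finset.add_sum_erase _ (fun α => q α * lam α) hl]
  have : ∀ α ∈ (Finset.univ.erase (π.winner t)).erase (π.loser t),
      π.push t q α * π.nextLengths t lam α = q α * lam α := fun α hα => by
    simp only [Finset.mem_erase, Finset.mem_univ, and_true] at hα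
    simp [push, nextLengths, hα.1, hα.2]
  rw [Finset.sum_congr rfl this]
  simp only [push, nextLengths, Function.update_self, Function.update_of_ne h,
    Function.update_of_ne h.symm]
  ring

lemma sum_weightAfter_le_succ (N : ℕ) : ∀ (π : GenPerm A n) (q lam : A → ℝ), (∀ α, 0 < q α) →
    ∑ α, weightAfter N π q lam α ≤ ∑ α, weightAfter (N + 1) π q lam α := by
  induction N with
  | zero =>
    intro π q lam hq
    cases h : rauzyType (π, lam) with
    | none => rw [weightAfter_of_none h, weightAfter_of_none h]
    | some t =>
      rw [weightAfter_succ h]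
      exact Finset.sum_le_sum fun α _ => le_push π t hq α
  | succ N ih =>
    intro π q lam hq
    cases h : rauzyType (π, lam) with
    | none => rw [weightAfter_of_none h, weightAfter_of_none h]
    | some t =>
      rw [weightAfter_succ h, weightAfter_succ h]
      exact ih _ _ _ (push_pos π t hq)

lemma weightAfter_of_iter (hn : 2 ≤ n) (N : ℕ) : ∀ (π : GenPerm A n) (q lam : A → ℝ)
    (y : Data A n), (∀ α, 1 ≤ q α) → (∀ α, 0 < lam α) → iter rauzyStep N (π, lam) = some y →
    (∀ α, 0 < y.2 α) ∧ ∑ α, weightAfter N π q lam α * y.2 α = ∑ α, q α * lam α ∧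
      ∑ α, q α + N ≤ ∑ α, weightAfter N π q lam α := by
  induction N with
  | zero =>
    intro π q lam y _ hlam h
    simp only [iter, Option.some.injEq] at h
    subst h
    simpa [weightAfter] using hlam
  | succ N ih =>
    intro π q lam y hq hlam h
    rw [iter_succ_eq_bind, Option.bind_eq_some_iff] at h
    obtain ⟨z, hz, hy⟩ := h
    rw [rauzyStep_eq_map, Option.map_eq_some_iff] at hz
    obtain ⟨t, ht, rfl⟩ := hz
    obtain ⟨hirr, hlt⟩ := (rauzyType_eq_some_iff π lam t).1 ht
    have hq0 : ∀ α, 0 < q α := fun α => one_pos.trans_le (hq α)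
    obtain ⟨h1, h2, h3⟩ := ih _ (π.push t q) _ y (fun α => (hq α).trans (le_push π t hq0 α))
      (nextLengths_pos hlam hlt) hy
    rw [weightAfter_succ ht]
    refine ⟨h1, h2.trans (sum_push_mul_nextLengths (hirr.winner_ne_loser hn t) q lam), ?_⟩
    rw [sum_push π t q _ (Finset.mem_univ _)] at h3
    push_cast
    linarith [hq (π.winner t)]

/-- The sum of the column sums of the matrix of the first `N` moves of Rauzy induction. -/
noncomputable def matrixSize (π : GenPerm A n) (N : ℕ) (lam : A → ℝ) : ℝ :=
  ∑ α, weightAfter N π 1 lam α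

lemma matrixSize_pos (π : GenPerm A n) (N : ℕ) (lam : A → ℝ) : 0 < π.matrixSize N lam :=
  sum_pos_of_pos π (weightAfter_pos N π 1 lam fun _ => one_pos)

lemma monotone_matrixSize (π : GenPerm A n) (lam : A → ℝ) :
    Monotone fun N => π.matrixSize N lam :=
  monotone_nat_of_le_succ fun N => sum_weightAfter_le_succ N π 1 lam fun _ => one_pos

lemma one_add_le_matrixSize (hn : 2 ≤ n) {π : GenPerm A n} {lam : A → ℝ} {N : ℕ} {y : Data A n}
    (hlam : ∀ α, 0 < lam α) (h : iter rauzyStep N (π, lam) = some y) :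
    1 + N ≤ π.matrixSize N lam := by
  have h1 := (weightAfter_of_iter hn N π 1 lam y (fun _ => le_rfl) hlam h).2.2
  have h2 : (1 : ℝ) ≤ ∑ α : A, (1 : A → ℝ) α :=
    Finset.single_le_sum (f := (1 : A → ℝ)) (fun _ _ => zero_le_one)
      (Finset.mem_univ (π.top.symm ⊤))
  exact (add_le_add_left h2 _).trans h1

/-- With q the column sums and λ' the lengths reached, 1 = ⟨q, λ'⟩ ≤ (∑ q) ‖λ'‖. -/
lemma renormTime_le_log_matrixSize (hn : 2 ≤ n) {π : GenPerm A n} {lam : A → ℝ} {N : ℕ}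
    {y : Data A n} (hlam : ∀ α, 0 < lam α) (hsum : ∑ α, lam α = 1)
    (h : iter rauzyStep N (π, lam) = some y) :
    renormTime (some y) ≤ ((Real.log (π.matrixSize N lam) : ℝ) : EReal) := by
  obtain ⟨h1, h2, -⟩ := weightAfter_of_iter hn N π 1 lam y (fun _ => le_rfl) hlam h
  have hW := weightAfter_pos N π 1 lam fun _ => one_pos
  have hy := sum_pos_of_pos π h1
  simp only [Pi.one_apply, one_mul, hsum] at h2
  rw [renormTime, EReal.coe_le_coe_iff, ← Real.log_inv]
  refine Real.log_le_log (by positivity) ((inv_le_iff_one_le_mul₀ hy).2 ?_)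
  rw [← h2, matrixSize, Finset.sum_mul]
  refine Finset.sum_le_sum fun α _ => ?_
  have := Finset.single_le_sum (fun α _ => (h1 α).le) (Finset.mem_univ α)
  have := hW α
  gcongr

/-- The roof function is bounded by the logarithmic size of the matrices of the orbit. -/
lemma exp_roof_le (hn : 2 ≤ n) (accelerated : Bool) (conv : StopConvention) (π : GenPerm A n)
    (γ : List Move) {lam : A → ℝ} (hlam : ∀ α, 0 < lam α) (hsum : ∑ α, lam α = 1) {σ : ℝ}
    (hσ : 0 < σ) : EReal.exp ((σ : EReal) * roof accelerated conv π γ lam) ≤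
      ⨆ N, ENNReal.ofReal (π.matrixSize N lam ^ σ) := by
  classical
  have hfin : ∀ N, roof accelerated conv π γ lam ≤ ((Real.log (π.matrixSize N lam) : ℝ) : EReal) →
      EReal.exp ((σ : EReal) * roof accelerated conv π γ lam) ≤
        ⨆ N, ENNReal.ofReal (π.matrixSize N lam ^ σ) := fun N h => by
    refine le_trans ?_ (le_iSup _ N)
    rw [Real.rpow_def_of_pos (π.matrixSize_pos N lam), ← EReal.exp_coe, EReal.exp_le_exp_iff,
      mul_comm (Real.log _), EReal.coe_mul]
    exact mul_le_mul_of_nonneg_left h (by exact_mod_cast hσ.le)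
  by_cases hret : ∃ k, ReturnsAt accelerated π γ (π, lam) k
  · obtain ⟨-, y, hy, -⟩ := Nat.find_spec hret
    obtain ⟨m, hm⟩ := exists_iter_rauzyStep_of_iter accelerated _ hy
    refine hfin m ?_
    rw [roof, dif_pos hret, hy]
    exact renormTime_le_log_matrixSize hn hlam hsum hm
  by_cases hhalt : ∃ N, StopsAt (π, lam) N
  · obtain ⟨y, hy, -⟩ := Nat.find_spec hhalt
    refine hfin (Nat.find hhalt) ?_
    rw [roof, dif_neg hret, dif_pos hhalt]
    cases conv
    · simp only [EReal.coe_le_coe_iff]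
      have h1 := one_add_le_matrixSize hn hlam hy
      -- If the induction stops at once, the value is `Real.log 0 = 0`, and the size is at least 1.
      rcases Nat.eq_zero_or_pos (Nat.find hhalt) with h0 | h0
      · rw [h0, Nat.cast_zero, Real.log_zero]
        rw [h0, Nat.cast_zero, add_zero] at h1
        exact Real.log_nonneg h1
      · exact Real.log_le_log (by exact_mod_cast h0) (by linarith)
    · simp only [hy]
      exact renormTime_le_log_matrixSize hn hlam hsum hy
  -- An infinite orbit: each move adds at least 1 to the size, so the supremum is infinite as well.
  · rw [iSup_eq_top.2 fun b hb => ?_]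
    · exact le_top
    · have htend : Filter.Tendsto (fun N : ℕ => ENNReal.ofReal ((N : ℝ) ^ σ)) Filter.atTop
          (nhds ⊤) :=
        ENNReal.tendsto_ofReal_nhds_top.2
          ((tendsto_rpow_atTop hσ).comp tendsto_natCast_atTop_atTop)
      obtain ⟨N, hN⟩ := (htend.eventually_const_lt hb).exists
      obtain ⟨y, hy⟩ := exists_iter_of_forall_not_stopsAt (not_exists.1 hhalt) N
      refine ⟨N, hN.trans_le (ENNReal.ofReal_le_ofReal ?_)⟩
      have := one_add_le_matrixSize hn hlam hy
      exact Real.rpow_le_rpow (by positivity) (by linarith) hσ.le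

end GenPerm

/-! ### Cones of lengths and the passage from volumes to the random walk. -/

section Cone

variable {A : Type*} [Fintype A]

/-- The positive vectors `lam` with `⟨q, lam⟩ < 1`. -/
def cone (q : A → ℝ) : Set (A → ℝ) :=
  {lam | (∀ α, 0 < lam α) ∧ ∑ α, q α * lam α < 1}

lemma measurableSet_cone (q : A → ℝ) : MeasurableSet (cone q) := by
  have h1 : MeasurableSet {lam : A → ℝ | ∀ α, 0 < lam α} := by
    rw [ofPred_forall]
    exact MeasurableSet.iInter fun α => measurableSet_lt measurable_const (measurable_pi_apply α)
  have h2 : MeasurableSet {lam : A → ℝ | ∑ α, q α * lam α < 1} :=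
    measurableSet_lt (by fun_prop) measurable_const
  exact h1.inter h2

lemma volume_cone_le {q : A → ℝ} (hq : ∀ α, 0 < q α) :
    volume (cone q) ≤ ENNReal.ofReal (∏ α, (q α)⁻¹) := by
  have hsub : cone q ⊆ univ.pi fun α => Ioo 0 (q α)⁻¹ := fun lam ⟨h1, h2⟩ α _ => by
    refine ⟨h1 α, ?_⟩
    rw [lt_inv_comm₀ (h1 α) (hq α), ← one_div, lt_div_iff₀ (h1 α)]
    exact (Finset.single_le_sum (f := fun α => q α * lam α)
      (fun α _ => (mul_pos (hq α) (h1 α)).le) (Finset.mem_univ α)).trans_lt h2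
  refine (measure_mono hsub).trans ?_
  rw [Real.volume_pi_Ioo, ENNReal.ofReal_prod_of_nonneg fun α _ => (inv_pos.2 (hq α)).le]
  simp

end Cone

namespace GenPerm

variable {A : Type*} {n : ℕ} [NeZero n] [DecidableEq A]

lemma measurable_nextLengths (π : GenPerm A n) (t : Move) : Measurable (π.nextLengths t) := by
  refine measurable_pi_iff.2 fun α => ?_
  by_cases hα : α = π.winner t
  · subst hα
    simp only [nextLengths, Function.update_self]
    fun_prop
  · simp only [nextLengths, Function.update_of_ne hα]
    fun_prop

lemma measurable_weightAfter (N : ℕ) : ∀ (π : GenPerm A n) (q : A → ℝ),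
    Measurable (weightAfter N π q) := by
  classical
  induction N with
  | zero => exact fun _ _ => measurable_const
  | succ N ih =>
    intro π q
    have hstep : ∀ t, Measurable fun lam =>
        weightAfter N (π.move t) (π.push t q) (π.nextLengths t lam) := fun t =>
      (ih _ _).comp (measurable_nextLengths π t)
    have heq : weightAfter (N + 1) π q = fun lam =>
        if rauzyType (π, lam) = some .a then
          weightAfter N (π.move .a) (π.push .a q) (π.nextLengths .a lam)
        else if rauzyType (π, lam) = some .b then
          weightAfter N (π.move .b) (π.push .b q) (π.nextLengths .b lam) else q := by
      funext lam
      rcases h : rauzyType (π, lam) with _ | ⟨_ | _⟩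
      · simp [weightAfter_of_none h]
      · simp [weightAfter_succ h]
      · simp [weightAfter_succ h]
    have hset : ∀ t, MeasurableSet {lam | rauzyType (π, lam) = some t} := fun t => by
      simp only [rauzyType_eq_some_iff]
      exact (MeasurableSet.const _).inter
        (measurableSet_lt (measurable_pi_apply _) (measurable_pi_apply _))
    rw [heq]
    exact (hstep .a).ite (hset .a) ((hstep .b).ite (hset .b) measurable_const)

variable [Fintype A]

lemma measurable_sum_weightAfter_rpow (N : ℕ) (π : GenPerm A n) (q : A → ℝ) (σ : ℝ) :
    Measurable fun lam => ENNReal.ofReal ((∑ α, weightAfter N π q lam α) ^ σ) := by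
  have h : Measurable fun lam => ∑ α, weightAfter N π q lam α :=
    Finset.measurable_sum _ fun α _ =>
      (measurable_pi_apply α).comp (measurable_weightAfter N π q)
  exact (h.pow_const σ).ennreal_ofReal

lemma measurePreserving_nextLengths {π : GenPerm A n} {t : Move}
    (h : π.winner t ≠ π.loser t) : MeasurePreserving (π.nextLengths t) := by
  convert Real.volume_preserving_transvectionStruct ⟨π.winner t, π.loser t, h, (-1 : ℝ)⟩ using 1
  funext lam
  rw [Matrix.toLin'_apply, Matrix.TransvectionStruct.toMatrix_mk, Matrix.transvection,
    Matrix.add_mulVec, Matrix.one_mulVec, Matrix.single_mulVec]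
  ext α
  by_cases hα : α = π.winner t
  · subst hα
    simp [nextLengths, sub_eq_add_neg]
  · simp [nextLengths, hα]

lemma nextLengths_preimage_cone {π : GenPerm A n} {t : Move} (h : π.winner t ≠ π.loser t)
    (q : A → ℝ) : π.nextLengths t ⁻¹' cone (π.push t q) =
      {lam | lam ∈ cone q ∧ lam (π.loser t) < lam (π.winner t)} := by
  ext lam
  simp only [cone, mem_preimage, mem_ofPred_eq, sum_push_mul_nextLengths h]
  constructor
  · rintro ⟨h1, h2⟩
    have hl := h1 (π.loser t)
    have hw := h1 (π.winner t)
    simp only [nextLengths, Function.update_self, Function.update_of_ne h.symm] at hl hw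
    refine ⟨⟨fun α => ?_, h2⟩, by linarith⟩
    by_cases hα : α = π.winner t
    · subst hα
      linarith
    · have := h1 α
      rwa [nextLengths, Function.update_of_ne hα] at this
  · rintro ⟨⟨h1, h2⟩, h3⟩
    exact ⟨nextLengths_pos h1 h3, h2⟩

/-- The source of the transition probabilities: the factor is the ratio of the volumes of the new
and the old cone. -/
lemma prod_inv_push (π : GenPerm A n) (t : Move) (q : A → ℝ) (hq : ∀ α, 0 < q α) :
    ∏ α, (π.push t q α)⁻¹ =
      q (π.loser t) / (q (π.loser t) + q (π.winner t)) * ∏ α, (q α)⁻¹ := by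
  rw [← Finset.mul_prod_erase _ _ (Finset.mem_univ (π.loser t)),
    ← Finset.mul_prod_erase _ (fun α => (q α)⁻¹) (Finset.mem_univ (π.loser t)), push_loser]
  rw [Finset.prod_congr rfl fun α hα => by
    rw [push_of_ne π t q (Finset.ne_of_mem_erase hα)]]
  have hl := hq (π.loser t)
  have hw := hq (π.winner t)
  field_simp
  ring

lemma expSize_nonneg (σ : ℝ) (N : ℕ) : ∀ (π : GenPerm A n) (q : A → ℝ), (∀ α, 0 < q α) →
    0 ≤ expSize σ N π q := by
  induction N with
  | zero => exact fun π q hq => Real.rpow_nonneg (sum_pos_of_pos π hq).le _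
  | succ N ih =>
    intro π q hq
    unfold expSize
    split_ifs with h
    · exact (avg_const π hq 0).ge.trans (avg_mono π hq fun t => ih _ _ (push_pos π t hq))
    · exact Real.rpow_nonneg (sum_pos_of_pos π hq).le _

lemma volume_eq_zero_of_ne {x y : A} (h : x ≠ y) : volume {lam : A → ℝ | lam x = lam y} = 0 := by
  let S : Submodule ℝ (A → ℝ) :=
    LinearMap.ker (LinearMap.proj (R := ℝ) (φ := fun _ : A => ℝ) x - LinearMap.proj y)
  have hS : (S : Set (A → ℝ)) = {lam : A → ℝ | lam x = lam y} := by
    ext lam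
    simp [S, sub_eq_zero]
  rw [← hS]
  refine Measure.addHaar_submodule _ _ fun htop => ?_
  have : Pi.single x (1 : ℝ) ∈ (S : Set (A → ℝ)) := by
    rw [htop]
    trivial
  rw [hS] at this
  simp [h.symm] at this

/-- The expectation `expSize` dominates an integral over a cone of lengths. -/
lemma lintegral_cone_le (hn : 2 ≤ n) (σ : ℝ) (N : ℕ) : ∀ (π : GenPerm A n) (q : A → ℝ),
    (∀ α, 0 < q α) →
    ∫⁻ lam in cone q, ENNReal.ofReal ((∑ α, weightAfter N π q lam α) ^ σ) ≤
      ENNReal.ofReal (expSize σ N π q * ∏ α, (q α)⁻¹) := by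
  have hconst : ∀ (π : GenPerm A n) (q : A → ℝ), (∀ α, 0 < q α) →
      ∫⁻ _ in cone q, ENNReal.ofReal ((∑ α, q α) ^ σ) ≤
        ENNReal.ofReal ((∑ α, q α) ^ σ * ∏ α, (q α)⁻¹) := fun π q hq => by
    rw [setLIntegral_const, ENNReal.ofReal_mul (Real.rpow_nonneg (sum_pos_of_pos π hq).le _)]
    gcongr
    exact volume_cone_le hq
  induction N with
  | zero => exact hconst
  | succ N ih =>
    intro π q hq
    by_cases hirr : π.Irreducible
    swap
    · have h0 : ∀ lam, rauzyType (π, lam) = none := fun lam => by simp [rauzyType, hirr]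
      simp only [weightAfter_of_none (h0 _), expSize, if_neg hirr]
      exact hconst π q hq
    have hne : ∀ t, π.winner t ≠ π.loser t := hirr.winner_ne_loser hn
    have hcover : cone q ⊆ (π.nextLengths .a ⁻¹' cone (π.push .a q) ∪
        π.nextLengths .b ⁻¹' cone (π.push .b q)) ∪
          {lam : A → ℝ | lam (π.winner .a) = lam (π.loser .a)} := fun lam hlam => by
      rw [nextLengths_preimage_cone (hne _), nextLengths_preimage_cone (hne _)]
      rcases lt_trichotomy (lam (π.winner .a)) (lam (π.loser .a)) with h | h | h
      · exact .inl (.inr ⟨hlam, h⟩)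
      · exact .inr h
      · exact .inl (.inl ⟨hlam, h⟩)
    have hpiece : ∀ t, ∫⁻ lam in π.nextLengths t ⁻¹' cone (π.push t q),
          ENNReal.ofReal ((∑ α, weightAfter (N + 1) π q lam α) ^ σ) ≤
        ENNReal.ofReal (expSize σ N (π.move t) (π.push t q) * ∏ α, (π.push t q α)⁻¹) :=
      fun t => by
      refine le_trans (le_of_eq ?_) (ih (π.move t) (π.push t q) (push_pos π t hq))
      rw [← (measurePreserving_nextLengths (hne t)).setLIntegral_comp_preimage
        (measurableSet_cone _) (measurable_sum_weightAfter_rpow N _ _ σ)]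
      refine setLIntegral_congr_fun
        (measurable_nextLengths π t (measurableSet_cone (π.push t q))) fun lam hlam => ?_
      rw [nextLengths_preimage_cone (hne t)] at hlam
      simp only [weightAfter_succ ((rauzyType_eq_some_iff π lam t).2 ⟨hirr, hlam.2⟩)]
    have hnn : ∀ t, 0 ≤ expSize σ N (π.move t) (π.push t q) * ∏ α, (π.push t q α)⁻¹ := fun t =>
      mul_nonneg (expSize_nonneg σ N _ _ (push_pos π t hq))
        (Finset.prod_nonneg fun α _ => (inv_pos.2 (push_pos π t hq α)).le)
    calc _ ≤ _ := lintegral_mono_set hcover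
      _ ≤ _ := lintegral_union_le _ _ _
      _ ≤ _ := add_le_add (lintegral_union_le _ _ _)
        (setLIntegral_measure_zero _ _ (volume_eq_zero_of_ne (hne .a))).le
      _ ≤ _ := add_le_add (add_le_add (hpiece .a) (hpiece .b)) le_rfl
      _ = _ := by
        rw [add_zero, ← ENNReal.ofReal_add (hnn _) (hnn _), expSize, if_pos hirr, avg,
          prod_inv_push π _ q hq, prod_inv_push π _ q hq]
        congr 1
        have e1 : π.winner .a = π.loser .b := rfl
        have e2 : π.winner .b = π.loser .a := rfl
        rw [e1, e2]
        have h1 := hq (π.loser .a)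
        have h2 := hq (π.loser .b)
        field_simp
        ring

end GenPerm

/-! ### From the cone to the simplex. -/

section Simplex

variable {A : Type*} [DecidableEq A] [Fintype A]

/-- The vector of sum `s` with prescribed coordinates except at `β`. -/
def withSum (β : A) (s : ℝ) (x : {α : A // α ≠ β} → ℝ) (α : A) : ℝ :=
  if h : α ≠ β then x ⟨α, h⟩ else s - ∑ i, x i

lemma simplexLebesgue_eq_map (β : A) : simplexLebesgue β = volume.map (withSum β 1) := rfl

lemma withSum_smul (β : A) (c s : ℝ) (x : {α : A // α ≠ β} → ℝ) :
    withSum β (c * s) (c • x) = c • withSum β s x := by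
  ext α
  by_cases h : α = β <;> simp [withSum, h, mul_sub, Finset.mul_sum]

lemma sum_withSum (β : A) (s : ℝ) (x : {α : A // α ≠ β} → ℝ) : ∑ α, withSum β s x α = s := by
  rw [← Fintype.sum_subtype_add_sum_subtype (fun α => α ≠ β)]
  have h1 : ∀ i : {α : A // α ≠ β}, withSum β s x i = x i := fun i => by simp [withSum, i.2]
  have h2 : ∀ i : {α : A // ¬ α ≠ β}, withSum β s x i = s - ∑ i, x i := fun i => by
    simp [withSum, i.2]
  let _ : Unique {α : A // ¬ α ≠ β} := ⟨⟨⟨β, by simp⟩⟩, fun i => Subtype.ext (not_not.1 i.2)⟩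
  rw [Finset.sum_congr rfl fun i _ => h1 i, Finset.sum_congr rfl fun i _ => h2 i]
  simp

/-- The sum replaces the coordinate at `β` through a shear, so the cone can be sliced by the value
of the sum. -/
lemma measurePreserving_withSum (β : A) :
    MeasurePreserving (fun z : ({α : A // α ≠ β} → ℝ) × ℝ => withSum β z.2 z.1) := by
  let _ : Unique {α : A // ¬ α ≠ β} := ⟨⟨⟨β, by simp⟩⟩, fun i => Subtype.ext (not_not.1 i.2)⟩
  have h1 : MeasurePreserving
      (fun z : ({α : A // α ≠ β} → ℝ) × ℝ => (z.1, z.2 - ∑ i, z.1 i)) :=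
    (MeasurePreserving.id _).skew_product (g := fun (x : {α : A // α ≠ β} → ℝ) (s : ℝ) => s - ∑ i, x i)
      (by unfold Function.uncurry; fun_prop)
      (.of_forall fun x => (measurePreserving_sub_right volume (∑ i, x i)).map_eq)
  have hu : MeasurePreserving (MeasurableEquiv.funUnique {α : A // ¬ α ≠ β} ℝ).symm := by
    convert (volume_preserving_funUnique {α : A // ¬ α ≠ β} ℝ).symm <;> rfl
  have h2 : MeasurePreserving (Prod.map (id : ({α : A // α ≠ β} → ℝ) → _)
      (MeasurableEquiv.funUnique {α : A // ¬ α ≠ β} ℝ).symm) :=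
    (MeasurePreserving.id _).prod hu
  have h3 := (volume_preserving_piEquivPiSubtypeProd (fun _ : A => ℝ) (fun α => α ≠ β)).symm
  exact h3.comp (h2.comp h1)

/-- Integrals over the simplex of functions of the direction are bounded by integrals over the
cone. -/
lemma lintegral_simplexLebesgue_le (β : A) {H : (A → ℝ) → ℝ≥0∞} (hH : Measurable H)
    (hsmul : ∀ c : ℝ, 0 < c → ∀ lam, H (c • lam) = H lam) :
    ∃ C : ℝ≥0∞, C ≠ ⊤ ∧ ∫⁻ lam in {lam : A → ℝ | ∀ α, 0 < lam α}, H lam ∂(simplexLebesgue β) ≤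
      C * ∫⁻ lam in cone 1, H lam := by
  set d := Module.finrank ℝ ({α : A // α ≠ β} → ℝ)
  set P : Set (A → ℝ) := {lam : A → ℝ | ∀ α, 0 < lam α} with hPdef
  have hP : MeasurableSet P := by
    rw [hPdef, ofPred_forall]
    exact MeasurableSet.iInter fun α => measurableSet_lt measurable_const (measurable_pi_apply α)
  have hmeas := (measurePreserving_withSum β).measurable
  set F : (A → ℝ) → ℝ≥0∞ := (cone 1).indicator H with hF
  have hFm : Measurable F := hH.indicator (measurableSet_cone 1)
  set G : (A → ℝ) → ℝ≥0∞ := P.indicator H with hG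
  have hGm : Measurable G := hH.indicator hP
  have h1 : ∫⁻ lam in P, H lam ∂(simplexLebesgue β) = ∫⁻ x, G (withSum β 1 x) := by
    have hm1 : Measurable (withSum β 1) := hmeas.comp (measurable_id.prodMk measurable_const)
    rw [simplexLebesgue_eq_map, ← lintegral_indicator hP, lintegral_map hGm hm1]
  have h2 : ∫⁻ lam in cone 1, H lam = ∫⁻ s : ℝ, ∫⁻ x, F (withSum β s x) := by
    rw [← lintegral_indicator (measurableSet_cone 1),
      ← (measurePreserving_withSum β).lintegral_comp hFm]
    exact lintegral_prod_symm' _ (hFm.comp hmeas)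
  -- The slice of sum s is a copy of the simplex scaled by s, and `H` is invariant under scaling.
  -- For s > 1/2 the Jacobian costs at most 2^d, and the interval of length 1/2 costs a factor 2.
  have h3 : ∀ s ∈ Ioo (1 / 2 : ℝ) 1, ∫⁻ x, G (withSum β 1 x) ≤
      ENNReal.ofReal (2 ^ d) * ∫⁻ x, F (withSum β s x) := by
    intro s hs
    have hs0 : 0 < s := by linarith [hs.1]
    have hFG : ∀ x, F (withSum β s (s • x)) = G (withSum β 1 x) := fun x => by
      have : withSum β s (s • x) = s • withSum β 1 x := by
        rw [← withSum_smul, mul_one]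
      have hmem : s • withSum β 1 x ∈ cone 1 ↔ withSum β 1 x ∈ P := by
        simp only [cone, hPdef, mem_ofPred_eq, Pi.smul_apply, smul_eq_mul, Pi.one_apply, one_mul,
          mul_pos_iff_of_pos_left hs0, ← Finset.mul_sum, sum_withSum, mul_one, hs.2, and_true]
      rw [this, hF, hG]
      by_cases hx : withSum β 1 x ∈ P
      · rw [indicator_of_mem hx, indicator_of_mem (hmem.2 hx), hsmul s hs0]
      · rw [indicator_of_notMem hx, indicator_of_notMem fun h => hx (hmem.1 h)]
    have hms : Measurable fun x => F (withSum β s x) :=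
      hFm.comp (hmeas.comp (measurable_id.prodMk measurable_const))
    calc ∫⁻ x, G (withSum β 1 x) = ∫⁻ x, F (withSum β s (s • x)) := by simp only [hFG]
      _ = ∫⁻ x, F (withSum β s x) ∂(volume.map fun x => s • x) :=
        (lintegral_map hms (measurable_const_smul s)).symm
      _ = ENNReal.ofReal |(s ^ d)⁻¹| * ∫⁻ x, F (withSum β s x) := by
        rw [Measure.map_addHaar_smul _ hs0.ne', lintegral_smul_measure, smul_eq_mul]
      _ ≤ _ := by
        gcongr
        rw [abs_of_pos (by positivity), ← inv_pow]
        gcongr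
        rw [inv_le_comm₀ hs0 two_pos]
        linarith [hs.1]
  have hvol : volume (Ioo (1 / 2 : ℝ) 1) = ENNReal.ofReal (1 / 2) := by
    rw [Real.volume_Ioo]
    norm_num
  refine ⟨ENNReal.ofReal 2 * ENNReal.ofReal (2 ^ d), by finiteness, ?_⟩
  rw [h1, h2, mul_assoc, ← lintegral_const_mul' _ _ ENNReal.ofReal_ne_top]
  calc ∫⁻ x, G (withSum β 1 x)
      = ENNReal.ofReal 2 * ∫⁻ _ in Ioo (1 / 2 : ℝ) 1, ∫⁻ x, G (withSum β 1 x) := by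
        rw [setLIntegral_const, hvol, mul_comm (lintegral _ _), ← mul_assoc,
          ← ENNReal.ofReal_mul two_pos.le]
        norm_num
    _ ≤ _ := by
        refine mul_le_mul_right ?_ _
        exact (setLIntegral_mono' measurableSet_Ioo h3).trans (setLIntegral_le_lintegral _ _)

end Simplex

/-! ### Integrability over the simplex. -/

namespace GenPerm

variable {A : Type*} {n : ℕ} [NeZero n] [DecidableEq A] [Fintype A]

lemma measurable_iSup_matrixSize (π : GenPerm A n) (σ : ℝ) :
    Measurable fun lam => ⨆ N, ENNReal.ofReal (π.matrixSize N lam ^ σ) :=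
  .iSup fun N => measurable_sum_weightAfter_rpow N π 1 σ

lemma lintegral_iSup_matrixSize_lt_top (hn : 2 ≤ n) (π : GenPerm A n)
    (hπ : ∃ α, π.flipped α = true) (β : A) : ∃ σ : ℝ, 0 < σ ∧
      ∫⁻ lam in {lam : A → ℝ | ∀ α, 0 < lam α}, ⨆ N, ENNReal.ofReal (π.matrixSize N lam ^ σ)
        ∂(simplexLebesgue β) < ⊤ := by
  obtain ⟨σ, K, hσ, hK⟩ := exists_expSize_le (A := A) hn
  refine ⟨σ, hσ, ?_⟩
  have hm : ∀ N, Measurable fun lam => ENNReal.ofReal (π.matrixSize N lam ^ σ) := fun N =>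
    measurable_sum_weightAfter_rpow N π 1 σ
  obtain ⟨C, hC, hle⟩ := lintegral_simplexLebesgue_le β (π.measurable_iSup_matrixSize σ) fun c hc lam => by
    simp only [matrixSize, weightAfter_smul hc]
  refine hle.trans_lt (ENNReal.mul_lt_top hC.lt_top ?_)
  -- The sizes increase with `N`, so monotone convergence reduces the supremum to the bounds for
  -- fixed `N`.
  have hmono : Monotone fun N => fun lam => ENNReal.ofReal (π.matrixSize N lam ^ σ) :=
    fun N N' h lam => ENNReal.ofReal_le_ofReal (Real.rpow_le_rpow (π.matrixSize_pos N lam).le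
      (π.monotone_matrixSize lam h) hσ.le)
  rw [lintegral_iSup hm hmono]
  refine (iSup_le fun N => ?_).trans_lt
    (ENNReal.ofReal_lt_top (r := K * (∑ α, (1 : A → ℝ) α) ^ σ * ∏ α, ((1 : A → ℝ) α)⁻¹))
  refine (lintegral_cone_le hn σ N π 1 fun _ => one_pos).trans (ENNReal.ofReal_le_ofReal ?_)
  gcongr
  · simp
  · exact hK N π 1 hπ fun _ => one_pos


lemma pos_of_mem_subsimplex {π : GenPerm A n} {γ : List Move} (hpos : π.IsPositive γ)
    {lam : A → ℝ} (h : lam ∈ π.subsimplex γ) (α : A) : 0 < lam α := by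
  obtain ⟨-, mu, hmu, rfl⟩ := h
  exact sum_pos_of_pos π fun β => mul_pos (hpos α β) (hmu β)

end GenPerm

end FIET

theorem mainTheorem4 {A : Type*} [Fintype A] [DecidableEq A] {n : ℕ} [NeZero n] (hn : 2 ≤ n)
    (π : FIET.GenPerm A n) (hflip : ∃ α, π.flipped α = true)
    (γ : List FIET.Move) (hpath : π.IsPath γ) (hloop : π.endpoint γ = π)
    (hcomplete : π.IsComplete γ) (hpos : π.IsPositive γ) (β : A) :
    ∃ σ : ℝ, 0 < σ ∧ ∀ (accelerated : Bool) (conv : FIET.StopConvention),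
      ∫⁻ lam in π.subsimplex γ,
        EReal.exp ((σ : EReal) * FIET.roof accelerated conv π γ lam)
          ∂(FIET.simplexLebesgue β) < ⊤ := by
  obtain ⟨σ, hσ, hfin⟩ := π.lintegral_iSup_matrixSize_lt_top hn hflip β
  refine ⟨σ, hσ, fun accelerated conv => lt_of_le_of_lt ?_ hfin⟩
  refine (MeasureTheory.setLIntegral_mono (π.measurable_iSup_matrixSize σ) fun lam hlam => ?_).trans
    (MeasureTheory.lintegral_mono_set fun lam hlam => FIET.GenPerm.pos_of_mem_subsimplex hpos hlam)
  exact FIET.GenPerm.exp_roof_le hn accelerated conv π γ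
    (FIET.GenPerm.pos_of_mem_subsimplex hpos hlam) hlam.1 hσ
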